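/- Let $(X^{2n},\omega)$ be a closed (compact, connected, without boundary) symplectic manifold that is monotone: there is $\kappa>0$ with $\int v^*\omega=\kappa\,\langle c_1(TX,\omega),[v]\rangle$ for every smooth sphere $v$ in $X$. Let $\{f_t\}_{t\in\mathbb R/\mathbb Z}$ be a Hamiltonian $S^1$-action on $X$ with moment map $F\in C^\infty(X)$, i.e. $\frac{d}{dt}f_t=X_F\circ f_t$ with $\omega(X_F,\cdot)=-dF$, $f_0=\mathrm{id}$, $f_{t+t'}=f_t\circ f_{t'}$ and $f_1=\mathrm{id}$. Let $s\in X$ be a Maslov-zero fixed point, i.e. $f_t(s)=s$ for all $t$ and the loop $\{d_sf_t\}_{t\in[0,1]}\subset Sp(T_sX,\omega)$ has Maslov index $0$. Suppose that $$\int_X F\,\omega^n\neq \mathrm{Vol}(X)\cdot F(s),\qquad \mathrm{Vol}(X)=\int_X\omega^n .$$ Then the loop $\{f_t\}_{t\in[0,1]}$ is non-contractible in the group $\mathrm{Ham}(X,\omega)$ of Hamiltonian diffeomorphisms: there is no family $\{h_{u,t}\}_{(u,t)\in[0,1]^2}$ of elements of $\mathrm{Ham}(X,\omega)$, smooth in $(u,t,x)$,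 with $h_{0,t}=\mathrm{id}$, $h_{1,t}=f_t$ and $h_{u,0}=h_{u,1}=\mathrm{id}$ for all $u,t\in[0,1]$. -/

import Mathlib

open Set MeasureTheory
open scoped Manifold ContDiff Bundle

noncomputable section

/-- The value `Ω^n(v₁, …, v₂ₙ)` of the `n`-th exterior power of a bilinear alternating form `Ω`,
with the convention under which `(∑ dxᵢ ∧ dyᵢ)^n` takes the value `n!` on the standard basis. -/
def wedgePower {V : Type*} (n : ℕ) (Ω : V → V → ℝ) (v : Fin (2 * n) → V) : ℝ :=
  (1 / 2 ^ n : ℝ) * ∑ σ : Equiv.Perm (Fin (2 * n)), ((Equiv.Perm.sign σ : ℤ) : ℝ) *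
    ∏ i : Fin n, Ω (v (σ ⟨2 * i, by omega⟩)) (v (σ ⟨2 * i + 1, by omega⟩))

/-- A basis `e₁, …, eₙ, f₁, …, fₙ` with `Ω(eᵢ, fⱼ) = δᵢⱼ` and `Ω(eᵢ, eⱼ) = Ω(fᵢ, fⱼ) = 0`. -/
def IsSymplecticBasis {V : Type*} [AddCommGroup V] [Module ℝ V] {n : ℕ} (Ω : V → V → ℝ)
    (b : Module.Basis (Fin n ⊕ Fin n) ℝ V) : Prop :=
  ∀ i j : Fin n, Ω (b (.inl i)) (b (.inr j)) = (if i = j then 1 else 0) ∧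
    Ω (b (.inl i)) (b (.inl j)) = 0 ∧ Ω (b (.inr i)) (b (.inr j)) = 0

/-- The complex matrix `X + iY`, seen as the real matrix `(X, -Y; Y, X)`. -/
def realification {n : ℕ} (U : Matrix (Fin n) (Fin n) ℂ) :
    Matrix (Fin n ⊕ Fin n) (Fin n ⊕ Fin n) ℝ :=
  Matrix.fromBlocks (U.map Complex.re) (-(U.map Complex.im)) (U.map Complex.im) (U.map Complex.re)

/-- The loop `A : [0,1] → Sp(V, Ω)` has Maslov index `k`: in a symplectic basis, if
`A t = U t * P t` is the polar decomposition (`U t` unitary, `P t` symmetric positive definite),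
then the loop `t ↦ det_ℂ (U t)` in the unit circle has degree `k`. -/
def HasMaslovIndex {V : Type*} [AddCommGroup V] [Module ℝ V] (n : ℕ) (Ω : V → V → ℝ)
    (A : ℝ → V →ₗ[ℝ] V) (k : ℤ) : Prop :=
  ∃ (b : Module.Basis (Fin n ⊕ Fin n) ℝ V) (U : ℝ → Matrix (Fin n) (Fin n) ℂ)
    (P : ℝ → Matrix (Fin n ⊕ Fin n) (Fin n ⊕ Fin n) ℝ) (θ : ℝ → ℝ),
    IsSymplecticBasis Ω b ∧ ContinuousOn θ (Icc 0 1) ∧ θ 1 - θ 0 = 2 * Real.pi * k ∧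
    ∀ t ∈ Icc (0 : ℝ) 1, U t ∈ Matrix.unitaryGroup (Fin n) ℂ ∧ (P t).PosDef ∧
      LinearMap.toMatrix b b (A t) = realification (U t) * P t ∧
      (U t).det = Complex.exp (θ t * Complex.I)

/-- The closed unit square. -/
def unitSquare : Set (ℝ × ℝ) := Icc 0 1 ×ˢ Icc 0 1

section Manifold

variable {n : ℕ} {X : Type*} [TopologicalSpace X]
  [ChartedSpace (EuclideanSpace ℝ (Fin (2 * n))) X]

/-- The expression of a bilinear form on the tangent spaces in the chart around `c`, at the point
`y` of the model space, on the pair of vectors `v`, `w`. -/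
def formInChart
    (B : ∀ x : X, TangentSpace (𝓡 (2 * n)) x →L[ℝ] TangentSpace (𝓡 (2 * n)) x →L[ℝ] ℝ)
    (c : X) (y v w : EuclideanSpace ℝ (Fin (2 * n))) : ℝ :=
  B ((extChartAt (𝓡 (2 * n)) c).symm y)
    (mfderiv 𝓘(ℝ, EuclideanSpace ℝ (Fin (2 * n))) (𝓡 (2 * n)) (extChartAt (𝓡 (2 * n)) c).symm y v)
    (mfderiv 𝓘(ℝ, EuclideanSpace ℝ (Fin (2 * n))) (𝓡 (2 * n)) (extChartAt (𝓡 (2 * n)) c).symm y w)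

variable (n X) in
/-- A symplectic form on the `2n`-dimensional smooth manifold `X`: a smooth, closed, pointwise
nondegenerate 2-form. Closedness, `dΩ = 0`, is expressed in the charts of `X`. -/
structure SymplecticForm [IsManifold (𝓡 (2 * n)) ∞ X] where
  toFun : ∀ x : X, TangentSpace (𝓡 (2 * n)) x →L[ℝ] TangentSpace (𝓡 (2 * n)) x →L[ℝ] ℝ
  contMDiff' : ContMDiff (𝓡 (2 * n))
    ((𝓡 (2 * n)).prod 𝓘(ℝ, EuclideanSpace ℝ (Fin (2 * n)) →L[ℝ]
      EuclideanSpace ℝ (Fin (2 * n)) →L[ℝ] ℝ)) ∞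
    (fun x ↦ Bundle.TotalSpace.mk' (EuclideanSpace ℝ (Fin (2 * n)) →L[ℝ]
      EuclideanSpace ℝ (Fin (2 * n)) →L[ℝ] ℝ) x (toFun x))
  alternating' : ∀ x v, toFun x v v = 0
  nondegenerate' : ∀ x v, (∀ w, toFun x v w = 0) → v = 0
  closed' : ∀ c : X, ∀ y ∈ (extChartAt (𝓡 (2 * n)) c).target,
    ∀ u v w : EuclideanSpace ℝ (Fin (2 * n)),
      fderiv ℝ (fun z ↦ formInChart toFun c z v w) y u
        + fderiv ℝ (fun z ↦ formInChart toFun c z w u) y v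
        + fderiv ℝ (fun z ↦ formInChart toFun c z u v) y w = 0

variable [IsManifold (𝓡 (2 * n)) ∞ X]

namespace SymplecticForm

/-- The measure on `X` defined by the volume form `Ω^n`, `X` being oriented by `Ω^n`. In the chart
around `c` it has the density `|Ω^n(∂₁, …, ∂₂ₙ)|`; these chart measures agree on overlaps, and the
supremum glues them. Thus `∫ F Ω^n` is `∫ x, F x ∂Ω.volumeMeasure`. -/
def volumeMeasure [MeasurableSpace X] (Ω : SymplecticForm n X) : Measure X :=
  ⨆ c : X, Measure.map (extChartAt (𝓡 (2 * n)) c).symm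
    ((volume.restrict (extChartAt (𝓡 (2 * n)) c).target).withDensity fun y ↦
      ENNReal.ofReal |wedgePower n (formInChart Ω.toFun c y)
        (fun i ↦ EuclideanSpace.single i (1 : ℝ))|)

/-- `ψ` is the flow of the time-dependent Hamiltonian `H`: it is smooth, starts at the identity, and
`d/dt ψ_t = X_{H_t} ∘ ψ_t`, where `Ω(X_{H_t}, ·) = -dH_t`. -/
structure IsHamiltonianFlow (Ω : SymplecticForm n X) (H : ℝ → X → ℝ) (ψ : ℝ → X → X) :
    Prop where
  contMDiff_hamiltonian :
    ContMDiff (𝓘(ℝ, ℝ).prod (𝓡 (2 * n))) 𝓘(ℝ, ℝ) ∞ (fun p : ℝ × X ↦ H p.1 p.2)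
  contMDiff_flow :
    ContMDiff (𝓘(ℝ, ℝ).prod (𝓡 (2 * n))) (𝓡 (2 * n)) ∞ (fun p : ℝ × X ↦ ψ p.1 p.2)
  zero : ∀ x, ψ 0 x = x
  hamilton : ∀ (t : ℝ) (x : X) (w : TangentSpace (𝓡 (2 * n)) (ψ t x)),
    Ω.toFun (ψ t x) (mfderiv 𝓘(ℝ, ℝ) (𝓡 (2 * n)) (fun τ ↦ ψ τ x) t (1 : ℝ)) w
      = -(mfderiv (𝓡 (2 * n)) 𝓘(ℝ, ℝ) (H t) (ψ t x) w : ℝ)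

/-- `Ham(X, Ω)`: the time-one maps of flows of time-dependent Hamiltonians. -/
def Ham (Ω : SymplecticForm n X) : Set (X → X) :=
  {φ | ∃ (H : ℝ → X → ℝ) (ψ : ℝ → X → X), Ω.IsHamiltonianFlow H ψ ∧ ψ 1 = φ}

/-- `f` is a Hamiltonian action of the circle `ℝ/ℤ` with moment map `F`. -/
structure IsHamiltonianCircleAction (Ω : SymplecticForm n X) (F : X → ℝ) (f : ℝ → X → X) :
    Prop where
  isHamiltonianFlow : Ω.IsHamiltonianFlow (fun _ ↦ F) f
  add : ∀ (t t' : ℝ) (x : X), f (t + t') x = f t (f t' x)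
  periodic : ∀ x, f 1 x = x

/-- `s` is a fixed point of the action `f`, and the loop of differentials
`d_s f_t ∈ Sp(T_s X, Ω)`, `t ∈ [0,1]`, has Maslov index zero. -/
def IsMaslovZeroFixedPoint (Ω : SymplecticForm n X) (f : ℝ → X → X) (s : X) : Prop :=
  (∀ t, f t s = s) ∧
    HasMaslovIndex (V := TangentSpace (𝓡 (2 * n)) s) n (fun v w ↦ Ω.toFun s v w)
      (fun t ↦ (mfderiv (𝓡 (2 * n)) (𝓡 (2 * n)) (f t) s).toLinearMap) 0

/-- A smooth sphere in `X` based at `x₀`: a smooth map of the square that sends its whole boundary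
to `x₀`. -/
def IsSphere (n : ℕ) {X : Type*} [TopologicalSpace X]
    [ChartedSpace (EuclideanSpace ℝ (Fin (2 * n))) X] (v : ℝ × ℝ → X) (x₀ : X) : Prop :=
  ContMDiffOn 𝓘(ℝ, ℝ × ℝ) (𝓡 (2 * n)) ∞ v unitSquare ∧
    ∀ a ∈ Icc (0 : ℝ) 1, v (0, a) = x₀ ∧ v (1, a) = x₀ ∧ v (a, 0) = x₀ ∧ v (a, 1) = x₀

/-- The symplectic area `∫ v^*Ω` of a map of the square. -/
def area (Ω : SymplecticForm n X) (v : ℝ × ℝ → X) : ℝ :=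
  ∫ p in unitSquare, Ω.toFun (v p)
    (mfderivWithin 𝓘(ℝ, ℝ × ℝ) (𝓡 (2 * n)) v unitSquare p ((1, 0) : ℝ × ℝ))
    (mfderivWithin 𝓘(ℝ, ℝ × ℝ) (𝓡 (2 * n)) v unitSquare p ((0, 1) : ℝ × ℝ))

/-- The sphere `v` based at `x₀` has first Chern number `⟨c₁(TX, Ω), [v]⟩ = k`. Here `Φ` is a
symplectic trivialization of `v^*TX` over the square that is the identity of `T_{x₀}X` on three
sides; the clutching loop is its restriction to the fourth side, which the boundary orientation of
the square runs through in the direction of increasing `t`. As the constant frame rotates by the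
inverse of this loop with respect to `Φ`, the Chern number is minus the Maslov index of the loop. -/
def HasChernNumber (Ω : SymplecticForm n X) (v : ℝ × ℝ → X) (x₀ : X) (k : ℤ) : Prop :=
  ∃ Φ : ∀ p : ℝ × ℝ, TangentSpace (𝓡 (2 * n)) x₀ →L[ℝ] TangentSpace (𝓡 (2 * n)) (v p),
    (∀ w, ContinuousOn
      (fun p ↦ (⟨v p, Φ p w⟩ : TangentBundle (𝓡 (2 * n)) X)) unitSquare) ∧
    (∀ p ∈ unitSquare, ∀ w w', Ω.toFun (v p) (Φ p w) (Φ p w') = Ω.toFun x₀ w w') ∧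
    (∀ a ∈ Icc (0 : ℝ) 1, ∀ w, Φ (0, a) w = w ∧ Φ (a, 0) w = w ∧ Φ (a, 1) w = w) ∧
    HasMaslovIndex (V := TangentSpace (𝓡 (2 * n)) x₀) n (fun w w' ↦ Ω.toFun x₀ w w')
      (fun t ↦ (Φ (1, t)).toLinearMap) (-k)

/-- `(X, Ω)` is monotone: `[Ω] = κ c₁` on `π₂(X)` for a constant `κ > 0`. -/
def IsMonotone (Ω : SymplecticForm n X) : Prop :=
  ∃ κ : ℝ, 0 < κ ∧ ∀ (v : ℝ × ℝ → X) (x₀ : X) (k : ℤ),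
    IsSphere n v x₀ → Ω.HasChernNumber v x₀ k → Ω.area v = κ * k

/-- The loop `f_t`, `t ∈ [0,1]`, based at the identity, is contractible in `Ham(X, Ω)`: a smooth
family `h_{u,t} ∈ Ham(X, Ω)` of loops based at the identity joins the constant loop to it. -/
def IsContractibleInHam (Ω : SymplecticForm n X) (f : ℝ → X → X) : Prop :=
  ∃ h : ℝ × ℝ → X → X,
    ContMDiffOn (𝓘(ℝ, ℝ × ℝ).prod (𝓡 (2 * n))) (𝓡 (2 * n)) ∞
      (fun q : (ℝ × ℝ) × X ↦ h q.1 q.2) (unitSquare ×ˢ univ) ∧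
    (∀ p ∈ unitSquare, h p ∈ Ω.Ham) ∧
    ∀ a ∈ Icc (0 : ℝ) 1, h (0, a) = id ∧ h (1, a) = f a ∧ h (a, 0) = id ∧ h (a, 1) = id

end SymplecticForm

end Manifold

end

/-! A contraction of the loop, reparametrised so that it extends to the plane, is a square `G` of
symplectic maps that is the identity on three sides and runs through the loop on the fourth. Let `A
x` be the symplectic area of the square `p ↦ G p x`. Three facts about `A` give the theorem.

(1) `A - F` is constant. Closedness of the pullback of `Ω` to parameters times chart turns the
differential of the area density `σ` into boundary terms. Only the side carrying the loop
contributes, and it contributes `dF` (`setIntegral_fderiv_areaDensity`, `area_sub_eq`).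

(2) `A s = 0`. Over a fixed point the square is a sphere, and the differentials `d_s G_p` trivialise
the pulled back tangent bundle with clutching loop `d_s f_t`. Maslov index zero means Chern number
zero, so monotonicity gives area zero (`setIntegral_areaDensity_fixedPoint`).

(3) The integral of `A` over `X` is zero (`integral_area_eq_zero`). At fixed `x`, put `η = (dG)⁻¹
∂ᵤG` and `ξ = (dG)⁻¹ ∂ₜG`. They lie in the single symplectic space `T_x X`, and `σ = Ω(η, ξ)`.
Closedness becomes `∂ᵤξ = ∂ₜη - Z` with `Ω(Z, ·) = dσ`. Two integrations by parts write `2 A x` as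
an integral of terms `dσ_{p'}(ξ_p)` (`two_mul_area_eq`); the boundary terms vanish because along the
loop `ξ` keeps a fixed direction, the moment map being invariant under the action. Each term
integrates to zero over `X` because `G` preserves volume (`integral_crossDerivative`).

Hence `A = F - F s` has integral zero, which is the excluded equality. Of the elements of `Ham` only
symplecticity and injectivity are used, so no smooth choice of generating Hamiltonians over the
square is needed. -/

open Filter Topology

set_option maxSynthPendingDepth 3

/-! ### Derivatives of a bilinear form evaluated on moving vectors. -/

section Calculus

variable {W E : Type*} [NormedAddCommGroup W] [NormedSpace ℝ W] [NormedAddCommGroup E]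
  [NormedSpace ℝ E]

theorem fderiv_apply_apply {B : W → E →L[ℝ] E →L[ℝ] ℝ} {v w : W → E} {p : W}
    {B' : W →L[ℝ] E →L[ℝ] E →L[ℝ] ℝ} {v' w' : W →L[ℝ] E}
    (hB : HasFDerivAt B B' p) (hv : HasFDerivAt v v' p) (hw : HasFDerivAt w w' p) (a : W) :
    fderiv ℝ (fun q ↦ B q (v q) (w q)) p a
      = B' a (v p) (w p) + B p (v' a) (w p) + B p (v p) (w' a) := by
  rw [((hB.clm_apply hv).clm_apply hw).fderiv]
  simp
  ring

theorem fderiv_apply_apply_comp {B : E → E →L[ℝ] E →L[ℝ] ℝ} {g : W → E} {p : W}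
    (hB : DifferentiableAt ℝ B (g p)) (hg : DifferentiableAt ℝ g p)
    (hg' : DifferentiableAt ℝ (fderiv ℝ g) p) (a b d : W) :
    fderiv ℝ (fun q ↦ B (g q) (fderiv ℝ g q b) (fderiv ℝ g q d)) p a =
      fderiv ℝ B (g p) (fderiv ℝ g p a) (fderiv ℝ g p b) (fderiv ℝ g p d)
      + B (g p) (fderiv ℝ (fderiv ℝ g) p a b) (fderiv ℝ g p d)
      + B (g p) (fderiv ℝ g p b) (fderiv ℝ (fderiv ℝ g) p a d) := by
  have hBg : HasFDerivAt (fun q ↦ B (g q)) ((fderiv ℝ B (g p)).comp (fderiv ℝ g p)) p :=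
    hB.hasFDerivAt.comp p hg.hasFDerivAt
  have h := fderiv_apply_apply (B := fun q ↦ B (g q)) hBg
    (hg'.hasFDerivAt.clm_apply (hasFDerivAt_const b p))
    (hg'.hasFDerivAt.clm_apply (hasFDerivAt_const d p)) a
  simpa using h

theorem fderiv_apply_apply_const {B : E → E →L[ℝ] E →L[ℝ] ℝ} {p : E}
    (hB : DifferentiableAt ℝ B p) (a b d : E) :
    fderiv ℝ (fun q ↦ B q b d) p a = fderiv ℝ B p a b d := by
  have h := fderiv_apply_apply hB.hasFDerivAt (hasFDerivAt_const b p)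
    (hasFDerivAt_const d p) a
  simpa using h

end Calculus

/-! ### Pullbacks of the symplectic form to vector spaces. -/

section Pullback

variable {n : ℕ} {X : Type*} [TopologicalSpace X]
  [ChartedSpace (EuclideanSpace ℝ (Fin (2 * n))) X] [IsManifold (𝓡 (2 * n)) ∞ X]
  {W : Type*} [NormedAddCommGroup W] [NormedSpace ℝ W]
  {W' : Type*} [NormedAddCommGroup W'] [NormedSpace ℝ W']

/-- The pullback `G^*Ω` of a symplectic form to a vector space. -/
noncomputable def SymplecticForm.pullback (Ω : SymplecticForm n X) (G : W → X) (p : W) :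
    W →L[ℝ] W →L[ℝ] ℝ :=
  -- Tangent spaces are unfolded to the model space, so that `G^*Ω` takes values in one fixed normed
  -- space and can be differentiated.
  let A : W →L[ℝ] EuclideanSpace ℝ (Fin (2 * n)) := by exact mfderiv 𝓘(ℝ, W) (𝓡 (2 * n)) G p
  let B : EuclideanSpace ℝ (Fin (2 * n)) →L[ℝ] EuclideanSpace ℝ (Fin (2 * n)) →L[ℝ] ℝ := by
    exact Ω.toFun (G p)
  B.bilinearComp A A

namespace SymplecticForm

variable (Ω : SymplecticForm n X)

theorem pullback_apply (G : W → X) (p v w : W) :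
    Ω.pullback G p v w = Ω.toFun (G p) (mfderiv 𝓘(ℝ, W) (𝓡 (2 * n)) G p v)
      (mfderiv 𝓘(ℝ, W) (𝓡 (2 * n)) G p w) := rfl

theorem neg_swap (x : X) (v w : TangentSpace (𝓡 (2 * n)) x) :
    Ω.toFun x v w = -Ω.toFun x w v := by
  have h := Ω.alternating' x (v + w)
  simp only [map_add, add_apply, Ω.alternating' x v,
    Ω.alternating' x w] at h
  linarith

theorem pullback_swap (G : W → X) (p v w : W) :
    Ω.pullback G p v w = -Ω.pullback G p w v := Ω.neg_swap _ _ _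

theorem pullback_congr {G G' : W → X} {p : W} (h : G =ᶠ[𝓝 p] G') (v w : W) :
    Ω.pullback G p v w = Ω.pullback G' p v w := by
  have h1 := h.mfderiv_eq (I := 𝓘(ℝ, W)) (I' := 𝓡 (2 * n))
  have h2 := h.eq_of_nhds
  rw [pullback_apply, pullback_apply]
  -- The two differentials land in tangent spaces at points that are only propositionally equal;
  -- generalising first makes the substitution possible.
  generalize mfderiv 𝓘(ℝ, W) (𝓡 (2 * n)) G p = A at *
  generalize mfderiv 𝓘(ℝ, W) (𝓡 (2 * n)) G' p = A' at *
  generalize G p = y at *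
  subst h2
  obtain rfl : A = A' := h1
  rfl

theorem pullback_comp {K : W → X} {g : W' → W} {p : W'}
    (hK : MDifferentiableAt 𝓘(ℝ, W) (𝓡 (2 * n)) K (g p)) (hg : DifferentiableAt ℝ g p)
    (v w : W') :
    Ω.pullback (K ∘ g) p v w = Ω.pullback K (g p) (fderiv ℝ g p v) (fderiv ℝ g p w) := by
  rw [pullback_apply, pullback_apply, mfderiv_comp p hK hg.mdifferentiableAt, mfderiv_eq_fderiv]
  rfl

end SymplecticForm

theorem contMDiffOn_mfderiv_apply {S : Set W} (hS : IsOpen S) {G : W → X}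
    (hG : ContMDiffOn 𝓘(ℝ, W) (𝓡 (2 * n)) ∞ G S) (v : W) :
    ContMDiffOn 𝓘(ℝ, W) (𝓡 (2 * n)).tangent ∞
      (fun p ↦ (⟨G p, mfderiv 𝓘(ℝ, W) (𝓡 (2 * n)) G p v⟩ : TangentBundle (𝓡 (2 * n)) X)) S := by
  have h1 := hG.contMDiffOn_tangentMapWithin (m := ∞) (by simp) hS.uniqueMDiffOn
  have h2 : ContMDiffOn 𝓘(ℝ, W) 𝓘(ℝ, W).tangent ∞
      (fun p ↦ (⟨p, v⟩ : TangentBundle 𝓘(ℝ, W) W)) S :=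
    contMDiffOn_vectorSpace_iff_contDiffOn.2 contDiffOn_const
  refine (h1.comp h2 fun p hp ↦ hp).congr fun p hp ↦ ?_
  simp only [Function.comp, tangentMapWithin]
  rw [mfderivWithin_of_isOpen hS hp]

namespace SymplecticForm

variable (Ω : SymplecticForm n X)

theorem contDiffOn_pullback_apply {S : Set W} (hS : IsOpen S) {G : W → X}
    (hG : ContMDiffOn 𝓘(ℝ, W) (𝓡 (2 * n)) ∞ G S) (v w : W) :
    ContDiffOn ℝ ∞ (fun p ↦ Ω.pullback G p v w) S := by
  intro x hx
  have h : ContMDiffWithinAt 𝓘(ℝ, W) ((𝓡 (2 * n)).prod 𝓘(ℝ, ℝ)) ∞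
      (fun m ↦ Bundle.TotalSpace.mk' ℝ (E := Bundle.Trivial X ℝ) (G m)
        (Ω.toFun (G m) (mfderiv 𝓘(ℝ, W) (𝓡 (2 * n)) G m v)
          (mfderiv 𝓘(ℝ, W) (𝓡 (2 * n)) G m w))) S x := by
    apply ContMDiffWithinAt.clm_bundle_apply₂ (F₁ := EuclideanSpace ℝ (Fin (2 * n)))
      (F₂ := EuclideanSpace ℝ (Fin (2 * n)))
    · exact ContMDiffAt.comp_contMDiffWithinAt x Ω.contMDiff'.contMDiffAt (hG x hx)
    · exact contMDiffOn_mfderiv_apply hS hG v x hx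
    · exact contMDiffOn_mfderiv_apply hS hG w x hx
  simp only [Bundle.contMDiffWithinAt_totalSpace] at h
  exact h.2.contDiffWithinAt

theorem contDiffOn_pullback [FiniteDimensional ℝ W] {S : Set W} (hS : IsOpen S) {G : W → X}
    (hG : ContMDiffOn 𝓘(ℝ, W) (𝓡 (2 * n)) ∞ G S) :
    ContDiffOn ℝ ∞ (Ω.pullback G) S :=
  contDiffOn_clm_apply.2 fun v ↦ contDiffOn_clm_apply.2 fun w ↦
    Ω.contDiffOn_pullback_apply hS hG v w

end SymplecticForm

end Pullback

/-! ### Closedness of pullbacks, by reduction to charts. -/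

section Chart

variable {n : ℕ} {X : Type*} [TopologicalSpace X]
  [ChartedSpace (EuclideanSpace ℝ (Fin (2 * n))) X]
  {W : Type*} [NormedAddCommGroup W] [NormedSpace ℝ W]

variable (n) in
/-- The chart around `c`, as a partial equivalence onto an open subset of the model space. -/
noncomputable abbrev echart (c : X) : PartialEquiv X (EuclideanSpace ℝ (Fin (2 * n))) :=
  extChartAt (𝓡 (2 * n)) c

theorem isOpen_echart_target (c : X) : IsOpen (echart n c).target :=
  isOpen_extChartAt_target c

theorem echart_target_mem_nhds {c : X} {y : EuclideanSpace ℝ (Fin (2 * n))}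
    (hy : y ∈ (echart n c).target) : (echart n c).target ∈ 𝓝 y :=
  (isOpen_echart_target c).mem_nhds hy

omit [NormedSpace ℝ W] in
theorem eventuallyEq_echart_symm_comp {G : W → X} {c : X} {p : W} (hG : ContinuousAt G p)
    (hc : G p ∈ (echart n c).source) : G =ᶠ[𝓝 p] (echart n c).symm ∘ (echart n c ∘ G) := by
  filter_upwards [hG.preimage_mem_nhds
    ((isOpen_extChartAt_source (I := 𝓡 (2 * n)) c).mem_nhds hc)] with q hq
  exact ((echart n c).left_inv hq).symm

variable [IsManifold (𝓡 (2 * n)) ∞ X]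

theorem contMDiffOn_echart_symm (c : X) :
    ContMDiffOn 𝓘(ℝ, EuclideanSpace ℝ (Fin (2 * n))) (𝓡 (2 * n)) ∞ (echart n c).symm
      (echart n c).target :=
  contMDiffOn_extChartAt_symm c

theorem mdifferentiableAt_echart_symm {c : X} {y : EuclideanSpace ℝ (Fin (2 * n))}
    (hy : y ∈ (echart n c).target) :
    MDifferentiableAt 𝓘(ℝ, EuclideanSpace ℝ (Fin (2 * n))) (𝓡 (2 * n)) (echart n c).symm y :=
  ((contMDiffOn_echart_symm c).contMDiffAt (echart_target_mem_nhds hy)).mdifferentiableAt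
    (by simp)

theorem contMDiffAt_echart {c x : X} (hx : x ∈ (echart n c).source) :
    ContMDiffAt (𝓡 (2 * n)) 𝓘(ℝ, EuclideanSpace ℝ (Fin (2 * n))) ∞ (echart n c) x :=
  contMDiffAt_extChartAt' (by simpa using hx)

theorem contDiffAt_echart_comp {G : W → X} {c : X} {p : W}
    (hG : ContMDiffAt 𝓘(ℝ, W) (𝓡 (2 * n)) ∞ G p) (hc : G p ∈ (echart n c).source) :
    ContDiffAt ℝ ∞ (echart n c ∘ G) p :=
  ((contMDiffAt_echart hc).comp p hG).contDiffAt

theorem SymplecticForm.pullback_eq_chart (Ω : SymplecticForm n X) {G : W → X} {c : X} {p : W}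
    (hG : ContMDiffAt 𝓘(ℝ, W) (𝓡 (2 * n)) ∞ G p) (hc : G p ∈ (echart n c).source) (v w : W) :
    Ω.pullback G p v w = Ω.pullback (echart n c).symm (echart n c (G p))
      (fderiv ℝ (echart n c ∘ G) p v) (fderiv ℝ (echart n c ∘ G) p w) := by
  rw [Ω.pullback_congr (eventuallyEq_echart_symm_comp hG.continuousAt hc)]
  exact Ω.pullback_comp (p := p) (g := echart n c ∘ G) (mdifferentiableAt_echart_symm ((echart n c).map_source hc))
    ((contDiffAt_echart_comp hG hc).differentiableAt (by simp)) v w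

/-- Naturality of `d`. With `g` the chart expression of `G`, the pullback is `g^*B`, and its
exterior derivative is `g^*(dB)` because the second derivatives of `g` drop out. -/
theorem SymplecticForm.pullback_closed (Ω : SymplecticForm n X) {S : Set W} (hS : IsOpen S)
    {G : W → X} (hGS : ContMDiffOn 𝓘(ℝ, W) (𝓡 (2 * n)) ∞ G S) {p : W} (hp : p ∈ S) (u v w : W) :
    fderiv ℝ (fun q ↦ Ω.pullback G q v w) p u + fderiv ℝ (fun q ↦ Ω.pullback G q w u) p v
      + fderiv ℝ (fun q ↦ Ω.pullback G q u v) p w = 0 := by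
  have hG := hGS.contMDiffAt (hS.mem_nhds hp)
  set c := G p
  have hc : G p ∈ (echart n c).source := mem_extChartAt_source c
  set g := echart n c ∘ G with hgdef
  have hg : ContDiffAt ℝ ∞ g p := contDiffAt_echart_comp hG hc
  have hgp : g p ∈ (echart n c).target := (echart n c).map_source hc
  set B := Ω.pullback (echart n c).symm with hBdef
  have hB : ContDiffOn ℝ ∞ B (echart n c).target :=
    Ω.contDiffOn_pullback (isOpen_echart_target c) (contMDiffOn_echart_symm c)
  have hBd : DifferentiableAt ℝ B (g p) :=
    (hB.contDiffAt (echart_target_mem_nhds hgp)).differentiableAt (by simp)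
  have hev : ∀ᶠ q in 𝓝 p, ∀ v w, Ω.pullback G q v w = B (g q) (fderiv ℝ g q v) (fderiv ℝ g q w) := by
    have h2 := hG.continuousAt.preimage_mem_nhds
      ((isOpen_extChartAt_source (I := 𝓡 (2 * n)) c).mem_nhds hc)
    filter_upwards [hS.mem_nhds hp, h2] with q hq1 hq2 v w
    exact Ω.pullback_eq_chart (hGS.contMDiffAt (hS.mem_nhds hq1)) hq2 v w
  have hg' : DifferentiableAt ℝ (fderiv ℝ g) p :=
    (hg.fderiv_right (m := ∞) (by simp)).differentiableAt (by simp)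
  have hgd : DifferentiableAt ℝ g p := hg.differentiableAt (by simp)
  have hsymm : IsSymmSndFDerivAt ℝ g p := hg.isSymmSndFDerivAt (by simpa using ENat.LEInfty.out)
  have key : ∀ a b d : W, fderiv ℝ (fun q ↦ Ω.pullback G q b d) p a =
      fderiv ℝ B (g p) (fderiv ℝ g p a) (fderiv ℝ g p b) (fderiv ℝ g p d)
      + B (g p) (fderiv ℝ (fderiv ℝ g) p a b) (fderiv ℝ g p d)
      + B (g p) (fderiv ℝ g p b) (fderiv ℝ (fderiv ℝ g) p a d) := by
    intro a b d
    have h1 : (fun q ↦ Ω.pullback G q b d) =ᶠ[𝓝 p]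
        fun q ↦ B (g q) (fderiv ℝ g q b) (fderiv ℝ g q d) := by
      filter_upwards [hev] with q hq using hq b d
    rw [h1.fderiv_eq]
    exact fderiv_apply_apply_comp hBd hgd hg' a b d
  have hcl := Ω.closed' c (g p) hgp (fderiv ℝ g p u) (fderiv ℝ g p v) (fderiv ℝ g p w)
  have hfc : ∀ a b d, fderiv ℝ (fun z ↦ formInChart Ω.toFun c z b d) (g p) a
      = fderiv ℝ B (g p) a b d := by
    intro a b d
    exact fderiv_apply_apply_const hBd a b d
  rw [hfc, hfc, hfc] at hcl
  -- The six terms with second derivatives of `g` cancel in pairs, by symmetry of the second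
  -- derivative and antisymmetry of `B`.
  rw [key, key, key, hsymm.eq u v, hsymm.eq w u, hsymm.eq w v,
    Ω.pullback_swap _ _ (fderiv ℝ g p w) (fderiv ℝ (fderiv ℝ g) p v u),
    Ω.pullback_swap _ _ (fderiv ℝ g p u) (fderiv ℝ (fderiv ℝ g) p v w),
    Ω.pullback_swap _ _ (fderiv ℝ g p v) (fderiv ℝ (fderiv ℝ g) p u w)]
  linarith

end Chart

/-! ### Families of maps read in a chart of the source. -/

section Slice

variable {n : ℕ} {X : Type*} [TopologicalSpace X]
  [ChartedSpace (EuclideanSpace ℝ (Fin (2 * n))) X]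
  {Q : Type*} [NormedAddCommGroup Q] [NormedSpace ℝ Q]

/-- The expression of a family of maps `Γ q : X → X` in the chart around `c` at the source. -/
noncomputable def chartSlice (Γ : Q → X → X) (c : X) (z : Q × EuclideanSpace ℝ (Fin (2 * n))) : X :=
  Γ z.1 ((echart n c).symm z.2)

variable (Q) in
omit [NormedSpace ℝ Q] in
theorem isOpen_univ_prod_echart_target (c : X) :
    IsOpen ((univ : Set Q) ×ˢ (echart n c).target) :=
  isOpen_univ.prod (isOpen_echart_target c)

variable [IsManifold (𝓡 (2 * n)) ∞ X]

theorem exists_mfderiv_echart_symm_eq {c : X} {y : EuclideanSpace ℝ (Fin (2 * n))}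
    (hy : y ∈ (echart n c).target) (v : TangentSpace (𝓡 (2 * n)) ((echart n c).symm y)) :
    ∃ b : EuclideanSpace ℝ (Fin (2 * n)), mfderiv 𝓘(ℝ, EuclideanSpace ℝ (Fin (2 * n)))
      (𝓡 (2 * n)) (echart n c).symm y b = v := by
  have : IsManifold (𝓡 (2 * n)) 1 X := IsManifold.of_le (n := ∞) (by simp)
  have h := mfderivWithin_extChartAt_symm_comp_mfderiv_extChartAt hy
  rw [ModelWithCorners.Boundaryless.range_eq_univ, mfderivWithin_univ] at h
  exact ⟨mfderiv (𝓡 (2 * n)) 𝓘(ℝ, EuclideanSpace ℝ (Fin (2 * n))) (echart n c)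
    ((echart n c).symm y) v, congrArg (fun A ↦ A v) h⟩

theorem contMDiffOn_prod_echart_symm {Y : Type*} [TopologicalSpace Y] {EY : Type*}
    [NormedAddCommGroup EY] [NormedSpace ℝ EY] {HY : Type*} [TopologicalSpace HY]
    {IY : ModelWithCorners ℝ EY HY} [ChartedSpace HY Y] {g : Q × X → Y}
    (hg : ContMDiff (𝓘(ℝ, Q).prod (𝓡 (2 * n))) IY ∞ g) (c : X) :
    ContMDiffOn 𝓘(ℝ, Q × EuclideanSpace ℝ (Fin (2 * n))) IY ∞
      (fun z ↦ g (z.1, (echart n c).symm z.2)) (univ ×ˢ (echart n c).target) := by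
  have h1 : ContMDiffOn 𝓘(ℝ, Q × EuclideanSpace ℝ (Fin (2 * n))) 𝓘(ℝ, Q) ∞
      (fun z : Q × EuclideanSpace ℝ (Fin (2 * n)) ↦ z.1) (univ ×ˢ (echart n c).target) :=
    contDiff_fst.contMDiff.contMDiffOn
  have h2 : ContMDiffOn 𝓘(ℝ, Q × EuclideanSpace ℝ (Fin (2 * n))) (𝓡 (2 * n)) ∞
      (fun z : Q × EuclideanSpace ℝ (Fin (2 * n)) ↦ (echart n c).symm z.2)
      (univ ×ˢ (echart n c).target) :=
    (contMDiffOn_echart_symm c).comp contDiff_snd.contMDiff.contMDiffOn fun z hz ↦ hz.2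
  exact hg.comp_contMDiffOn (h1.prodMk h2)

theorem contMDiffOn_chartSlice {Γ : Q → X → X}
    (hΓ : ContMDiff (𝓘(ℝ, Q).prod (𝓡 (2 * n))) (𝓡 (2 * n)) ∞ (fun p : Q × X ↦ Γ p.1 p.2))
    (c : X) :
    ContMDiffOn 𝓘(ℝ, Q × EuclideanSpace ℝ (Fin (2 * n))) (𝓡 (2 * n)) ∞
      (chartSlice Γ c) (univ ×ˢ (echart n c).target) :=
  contMDiffOn_prod_echart_symm hΓ c

variable {Γ : Q → X → X}
  (hΓ : ContMDiff (𝓘(ℝ, Q).prod (𝓡 (2 * n))) (𝓡 (2 * n)) ∞ (fun p : Q × X ↦ Γ p.1 p.2))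

include hΓ

omit [IsManifold (𝓡 (2 * n)) ∞ X] in
theorem contMDiff_family_apply (q : Q) : ContMDiff (𝓡 (2 * n)) (𝓡 (2 * n)) ∞ (Γ q) :=
  hΓ.comp (contMDiff_const.prodMk contMDiff_id)

omit [IsManifold (𝓡 (2 * n)) ∞ X] in
theorem contMDiff_family_param (x : X) :
    ContMDiff 𝓘(ℝ, Q) (𝓡 (2 * n)) ∞ (fun q ↦ Γ q x) :=
  hΓ.comp (contMDiff_id.prodMk contMDiff_const)

theorem mdifferentiableAt_chartSlice {c : X} {q : Q} {y : EuclideanSpace ℝ (Fin (2 * n))}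
    (hy : y ∈ (echart n c).target) :
    MDifferentiableAt 𝓘(ℝ, Q × EuclideanSpace ℝ (Fin (2 * n))) (𝓡 (2 * n))
      (chartSlice Γ c) (q, y) :=
  ((contMDiffOn_chartSlice hΓ c).contMDiffAt
    ((isOpen_univ_prod_echart_target Q c).mem_nhds ⟨mem_univ _, hy⟩)).mdifferentiableAt (by simp)

theorem mfderiv_chartSlice_left {c : X} {q : Q} {y : EuclideanSpace ℝ (Fin (2 * n))}
    (hy : y ∈ (echart n c).target) (a : Q) :
    mfderiv 𝓘(ℝ, Q × EuclideanSpace ℝ (Fin (2 * n))) (𝓡 (2 * n)) (chartSlice Γ c) (q, y)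
      ((a, 0) : Q × EuclideanSpace ℝ (Fin (2 * n)))
      = mfderiv 𝓘(ℝ, Q) (𝓡 (2 * n)) (fun r ↦ Γ r ((echart n c).symm y)) q a := by
  have h1 : HasFDerivAt (fun r : Q ↦ ((r, y) : Q × EuclideanSpace ℝ (Fin (2 * n))))
    (ContinuousLinearMap.inl ℝ Q _) q := hasFDerivAt_prodMk_left q y
  have h2 := mfderiv_comp (I := 𝓘(ℝ, Q)) q (f := fun r : Q ↦ (r, y))
    (mdifferentiableAt_chartSlice hΓ hy) h1.differentiableAt.mdifferentiableAt
  rw [mfderiv_eq_fderiv, h1.fderiv] at h2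
  exact (congrArg (fun A ↦ A a) h2).symm

theorem mfderiv_chartSlice_right {c : X} {q : Q} {y : EuclideanSpace ℝ (Fin (2 * n))}
    (hy : y ∈ (echart n c).target) (b : EuclideanSpace ℝ (Fin (2 * n))) :
    mfderiv 𝓘(ℝ, Q × EuclideanSpace ℝ (Fin (2 * n))) (𝓡 (2 * n)) (chartSlice Γ c) (q, y)
      ((0, b) : Q × EuclideanSpace ℝ (Fin (2 * n)))
      = mfderiv (𝓡 (2 * n)) (𝓡 (2 * n)) (Γ q) ((echart n c).symm y)
        (mfderiv 𝓘(ℝ, EuclideanSpace ℝ (Fin (2 * n))) (𝓡 (2 * n)) (echart n c).symm y b) := by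
  have h1 : HasFDerivAt (fun r ↦ ((q, r) : Q × EuclideanSpace ℝ (Fin (2 * n))))
    (ContinuousLinearMap.inr ℝ Q _) y := hasFDerivAt_prodMk_right q y
  have h2 := mfderiv_comp (I := 𝓘(ℝ, EuclideanSpace ℝ (Fin (2 * n)))) y (f := fun r ↦ (q, r))
    (mdifferentiableAt_chartSlice hΓ hy) h1.differentiableAt.mdifferentiableAt
  rw [mfderiv_eq_fderiv, h1.fderiv] at h2
  have h3 := mfderiv_comp (I := 𝓘(ℝ, EuclideanSpace ℝ (Fin (2 * n)))) (I' := 𝓡 (2 * n))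
    (I'' := 𝓡 (2 * n)) y (f := (echart n c).symm) (g := Γ q)
    ((contMDiff_family_apply hΓ q).mdifferentiableAt (by simp)) (mdifferentiableAt_echart_symm hy)
  exact (congrArg (fun A ↦ A b) h2).symm.trans (congrArg (fun A ↦ A b) h3)

end Slice

/-! ### Hamiltonian flows preserve the symplectic form. -/

section Symplectic

variable {n : ℕ} {X : Type*} [TopologicalSpace X]
  [ChartedSpace (EuclideanSpace ℝ (Fin (2 * n))) X] [IsManifold (𝓡 (2 * n)) ∞ X]

namespace SymplecticForm

/-- A smooth map that preserves the symplectic form. -/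
structure IsSymplecticMap (Ω : SymplecticForm n X) (φ : X → X) : Prop where
  contMDiff : ContMDiff (𝓡 (2 * n)) (𝓡 (2 * n)) ∞ φ
  map_form : ∀ (x : X) (v w : TangentSpace (𝓡 (2 * n)) x),
    Ω.toFun (φ x) (mfderiv (𝓡 (2 * n)) (𝓡 (2 * n)) φ x v)
      (mfderiv (𝓡 (2 * n)) (𝓡 (2 * n)) φ x w) = Ω.toFun x v w

variable {Ω : SymplecticForm n X} {H : ℝ → X → ℝ} {ψ : ℝ → X → X}

namespace IsHamiltonianFlow

/-- Hamilton's equation on time times chart: contracting the pulled back form with `∂ₜ` gives, in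
space directions, the exact form `-d(H_t ∘ ψ_t)`. -/
theorem pullback_chartSlice_time (hψ : Ω.IsHamiltonianFlow H ψ) {c : X}
    {z : ℝ × EuclideanSpace ℝ (Fin (2 * n))} (hz : z ∈ univ ×ˢ (echart n c).target)
    (b : EuclideanSpace ℝ (Fin (2 * n))) :
    Ω.pullback (chartSlice ψ c) z (1, 0) (0, b)
      = -fderiv ℝ (fun z : ℝ × EuclideanSpace ℝ (Fin (2 * n)) ↦
          H z.1 (chartSlice ψ c z)) z (0, b) := by
  obtain ⟨t, y⟩ := z
  have hy : y ∈ (echart n c).target := hz.2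
  have hG := contMDiffOn_chartSlice hψ.contMDiff_flow c
  have hGz := hG.contMDiffAt ((isOpen_univ_prod_echart_target ℝ c).mem_nhds hz)
  have hHz : ContMDiffAt 𝓘(ℝ, ℝ × EuclideanSpace ℝ (Fin (2 * n))) 𝓘(ℝ, ℝ) ∞
      (fun z : ℝ × EuclideanSpace ℝ (Fin (2 * n)) ↦ H z.1 (chartSlice ψ c z)) (t, y) :=
    hψ.contMDiff_hamiltonian.contMDiffAt.comp (t, y) (contDiff_fst.contMDiff.contMDiffAt.prodMk hGz)
  have hHd := hHz.contDiffAt.differentiableAt (by simp)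
  have h1 : HasFDerivAt (fun r ↦ ((t, r) : ℝ × EuclideanSpace ℝ (Fin (2 * n))))
    (ContinuousLinearMap.inr ℝ ℝ _) y := hasFDerivAt_prodMk_right t y
  have h2 := (hHd.hasFDerivAt.comp y h1).fderiv
  have hHt : MDifferentiableAt (𝓡 (2 * n)) 𝓘(ℝ, ℝ) (H t) (chartSlice ψ c (t, y)) :=
    (hψ.contMDiff_hamiltonian.comp (contMDiff_const.prodMk contMDiff_id)).mdifferentiableAt
      (by simp)
  have h3 := mfderiv_comp (I := 𝓘(ℝ, EuclideanSpace ℝ (Fin (2 * n)))) (I' := 𝓡 (2 * n))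
    (I'' := 𝓘(ℝ, ℝ)) y (f := fun r ↦ chartSlice ψ c (t, r)) (g := H t) hHt
    ((mdifferentiableAt_chartSlice hψ.contMDiff_flow hy).comp y
      h1.differentiableAt.mdifferentiableAt)
  have h4 := mfderiv_comp (I := 𝓘(ℝ, EuclideanSpace ℝ (Fin (2 * n)))) y (f := fun r ↦ (t, r))
    (mdifferentiableAt_chartSlice hψ.contMDiff_flow hy) h1.differentiableAt.mdifferentiableAt
  rw [mfderiv_eq_fderiv, h1.fderiv] at h4
  rw [pullback_apply, mfderiv_chartSlice_left hψ.contMDiff_flow hy]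
  refine (hψ.hamilton t _ _).trans ?_
  congr 1
  have e1 := congrArg (fun A ↦ A b) h2
  have e2 := congrArg (fun A ↦ A b) h3
  have e3 := congrArg (fun A ↦ A b) h4
  rw [mfderiv_eq_fderiv] at e2
  refine Eq.trans ?_ (e2.symm.trans e1)
  exact congrArg (fun w ↦ mfderiv (𝓡 (2 * n)) 𝓘(ℝ, ℝ) (H t) (chartSlice ψ c (t, y)) w) e3.symm

/-- Cartan's formula in coordinates. By closedness the time derivative is a difference of mixed
second derivatives of `H_t ∘ ψ_t`, which is zero. -/
theorem pullback_chartSlice (hψ : Ω.IsHamiltonianFlow H ψ) (c : X) (t : ℝ)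
    {y : EuclideanSpace ℝ (Fin (2 * n))} (hy : y ∈ (echart n c).target)
    (b d : EuclideanSpace ℝ (Fin (2 * n))) :
    Ω.pullback (chartSlice ψ c) (t, y) (0, b) (0, d)
      = Ω.pullback (chartSlice ψ c) (0, y) (0, b) (0, d) := by
  set S : Set (ℝ × EuclideanSpace ℝ (Fin (2 * n))) := univ ×ˢ (echart n c).target with hS
  have hSo : IsOpen S := isOpen_univ_prod_echart_target ℝ c
  have hG := contMDiffOn_chartSlice hψ.contMDiff_flow c
  set K : ℝ × EuclideanSpace ℝ (Fin (2 * n)) → ℝ := fun z ↦ H z.1 (chartSlice ψ c z) with hK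
  have hKs : ContDiffOn ℝ ∞ K S := by
    have : ContMDiffOn 𝓘(ℝ, ℝ × EuclideanSpace ℝ (Fin (2 * n))) 𝓘(ℝ, ℝ) ∞ K S :=
      hψ.contMDiff_hamiltonian.comp_contMDiffOn (contDiff_fst.contMDiff.contMDiffOn.prodMk hG)
    exact this.contDiffOn
  have hder : ∀ τ : ℝ, HasDerivAt
      (fun τ ↦ Ω.pullback (chartSlice ψ c) (τ, y) (0, b) (0, d)) 0 τ := by
    intro τ
    have hz : (τ, y) ∈ S := ⟨mem_univ _, hy⟩
    have hnz := hSo.mem_nhds hz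
    have h1 := ((Ω.contDiffOn_pullback_apply hSo hG (0, b) (0, d)).contDiffAt hnz).differentiableAt
      (by simp)
    have h2 : HasDerivAt (fun τ : ℝ ↦ (τ, y)) ((1 : ℝ), (0 : EuclideanSpace ℝ (Fin (2 * n)))) τ :=
      (hasDerivAt_id τ).prodMk (hasDerivAt_const τ y)
    have h3 := h1.hasFDerivAt.comp_hasDerivAt τ h2
    have hcl := Ω.pullback_closed hSo hG hz ((1 : ℝ), 0) (0, b) (0, d)
    have hK2 : ContDiffAt ℝ ∞ K (τ, y) := hKs.contDiffAt hnz
    have hK1 : DifferentiableAt ℝ (fderiv ℝ K) (τ, y) :=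
      (hK2.fderiv_right (m := ∞) (by simp)).differentiableAt (by simp)
    have hsymm : IsSymmSndFDerivAt ℝ K (τ, y) :=
      hK2.isSymmSndFDerivAt (by simpa using ENat.LEInfty.out)
    have e1 : fderiv ℝ (fun q ↦ Ω.pullback (chartSlice ψ c) q (0, d) (1, 0)) (τ, y) (0, b)
        = fderiv ℝ (fderiv ℝ K) (τ, y) (0, b) (0, d) := by
      have : (fun q ↦ Ω.pullback (chartSlice ψ c) q (0, d) (1, 0)) =ᶠ[𝓝 (τ, y)]
          fun q ↦ fderiv ℝ K q (0, d) := by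
        filter_upwards [hnz] with q hq
        rw [pullback_swap, hψ.pullback_chartSlice_time hq, neg_neg]
      rw [this.fderiv_eq, (hK1.hasFDerivAt.clm_apply (hasFDerivAt_const _ _)).fderiv]
      simp
    have e2 : fderiv ℝ (fun q ↦ Ω.pullback (chartSlice ψ c) q (1, 0) (0, b)) (τ, y) (0, d)
        = -fderiv ℝ (fderiv ℝ K) (τ, y) (0, d) (0, b) := by
      have : (fun q ↦ Ω.pullback (chartSlice ψ c) q (1, 0) (0, b)) =ᶠ[𝓝 (τ, y)]
          fun q ↦ -fderiv ℝ K q (0, b) := by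
        filter_upwards [hnz] with q hq
        rw [hψ.pullback_chartSlice_time hq]
      rw [this.fderiv_eq, fderiv_fun_neg,
        (hK1.hasFDerivAt.clm_apply (hasFDerivAt_const _ _)).fderiv]
      simp
    rw [e1, e2, hsymm.eq, add_neg_cancel_right] at hcl
    rwa [hcl] at h3
  exact is_const_of_deriv_eq_zero (fun τ ↦ (hder τ).differentiableAt) (fun τ ↦ (hder τ).deriv) t 0

theorem isSymplecticMap (hψ : Ω.IsHamiltonianFlow H ψ) (t : ℝ) : Ω.IsSymplecticMap (ψ t) := by
  refine ⟨contMDiff_family_apply hψ.contMDiff_flow t, fun x v w ↦ ?_⟩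
  have hx : x ∈ (echart n x).source := mem_extChartAt_source x
  have hy := (echart n x).map_source hx
  have hinv : (echart n x).symm (echart n x x) = x := (echart n x).left_inv hx
  have key : ∀ v w : TangentSpace (𝓡 (2 * n)) ((echart n x).symm (echart n x x)),
      Ω.toFun (ψ t ((echart n x).symm (echart n x x)))
        (mfderiv (𝓡 (2 * n)) (𝓡 (2 * n)) (ψ t) ((echart n x).symm (echart n x x)) v)
        (mfderiv (𝓡 (2 * n)) (𝓡 (2 * n)) (ψ t) ((echart n x).symm (echart n x x)) w)
        = Ω.toFun ((echart n x).symm (echart n x x)) v w := by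
    intro v w
    obtain ⟨b, rfl⟩ := exists_mfderiv_echart_symm_eq hy v
    obtain ⟨d, rfl⟩ := exists_mfderiv_echart_symm_eq hy w
    have h := hψ.pullback_chartSlice x t hy b d
    rw [pullback_apply, mfderiv_chartSlice_right hψ.contMDiff_flow hy,
      mfderiv_chartSlice_right hψ.contMDiff_flow hy] at h
    refine h.trans ?_
    have h0 : chartSlice ψ x ∘ (fun r ↦ ((0 : ℝ), r)) = (echart n x).symm := by
      funext r
      exact hψ.zero _
    have h1 := Ω.pullback_comp (K := chartSlice ψ x) (g := fun r ↦ ((0 : ℝ), r))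
      (p := echart n x x) (mdifferentiableAt_chartSlice hψ.contMDiff_flow hy)
      (hasFDerivAt_prodMk_right (0 : ℝ) _).differentiableAt b d
    rw [h0, (hasFDerivAt_prodMk_right (𝕜 := ℝ) (0 : ℝ) (echart n x x)).fderiv] at h1
    exact h1.symm
  rw [hinv] at key
  exact key v w

end IsHamiltonianFlow

end SymplecticForm

end Symplectic

/-! ### Hamiltonian flows are injective. -/

theorem isInvertible_of_nondegenerate {E : Type*} [NormedAddCommGroup E] [NormedSpace ℝ E]
    [FiniteDimensional ℝ E] (B : E →L[ℝ] E →L[ℝ] ℝ) (hB : ∀ v, (∀ w, B v w = 0) → v = 0) :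
    B.IsInvertible := by
  have hinj : Function.Injective (B : E →ₗ[ℝ] E →L[ℝ] ℝ) := by
    rw [← LinearMap.ker_eq_bot, LinearMap.ker_eq_bot']
    intro v hv
    exact hB v fun w ↦ congrArg (fun A : E →L[ℝ] ℝ ↦ A w) hv
  have hdim : Module.finrank ℝ E = Module.finrank ℝ (E →L[ℝ] ℝ) := by
    rw [← LinearEquiv.finrank_eq (LinearMap.toContinuousLinearMap (𝕜 := ℝ) (E := E) (F' := ℝ))]
    exact (Subspace.dual_finrank_eq (K := ℝ) (V := E)).symm
  exact ⟨(LinearMap.linearEquivOfInjective _ hinj hdim).toContinuousLinearEquiv, by ext; rfl⟩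

section Injective

variable {n : ℕ} {X : Type*} [TopologicalSpace X]
  [ChartedSpace (EuclideanSpace ℝ (Fin (2 * n))) X] [IsManifold (𝓡 (2 * n)) ∞ X]

namespace SymplecticForm

variable {Ω : SymplecticForm n X}

theorem mfderiv_echart_symm_injective {c : X} {y : EuclideanSpace ℝ (Fin (2 * n))}
    (hy : y ∈ (echart n c).target) {v : EuclideanSpace ℝ (Fin (2 * n))}
    (hv : mfderiv 𝓘(ℝ, EuclideanSpace ℝ (Fin (2 * n))) (𝓡 (2 * n)) (echart n c).symm y v = 0) :
    v = 0 := by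
  have : IsManifold (𝓡 (2 * n)) 1 X := IsManifold.of_le (n := ∞) (by simp)
  have h := mfderiv_extChartAt_comp_mfderivWithin_extChartAt_symm hy
  rw [ModelWithCorners.Boundaryless.range_eq_univ, mfderivWithin_univ] at h
  have h1 := congrArg (fun A ↦ A v) h
  refine h1.symm.trans ?_
  refine (congrArg (mfderiv (𝓡 (2 * n)) 𝓘(ℝ, EuclideanSpace ℝ (Fin (2 * n))) (echart n c)
    ((echart n c).symm y)) hv).trans (map_zero _)

variable (Ω) in
theorem isInvertible_pullback_echart_symm {c : X} {y : EuclideanSpace ℝ (Fin (2 * n))}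
    (hy : y ∈ (echart n c).target) : (Ω.pullback (echart n c).symm y).IsInvertible := by
  refine isInvertible_of_nondegenerate _ fun v hv ↦ ?_
  refine mfderiv_echart_symm_injective hy (Ω.nondegenerate' _ _ fun w ↦ ?_)
  obtain ⟨d, rfl⟩ := exists_mfderiv_echart_symm_eq hy w
  exact hv d

variable {H : ℝ → X → ℝ} {ψ : ℝ → X → X}

variable (Ω) in
/-- The Hamiltonian vector field of `H` in the chart around `c`. -/
noncomputable def chartHamiltonianField (H : ℝ → X → ℝ) (c : X)
    (z : ℝ × EuclideanSpace ℝ (Fin (2 * n))) : EuclideanSpace ℝ (Fin (2 * n)) :=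
  (Ω.pullback (echart n c).symm z.2).inverse
    (-(fderiv ℝ (fun z : ℝ × EuclideanSpace ℝ (Fin (2 * n)) ↦
      H z.1 ((echart n c).symm z.2)) z).comp (ContinuousLinearMap.inr ℝ ℝ _))

theorem contDiffAt_pullback_inverse {c : X} {y : EuclideanSpace ℝ (Fin (2 * n))}
    (hy : y ∈ (echart n c).target) :
    ContDiffAt ℝ ∞ (fun y ↦ (Ω.pullback (echart n c).symm y).inverse) y :=
  (Ω.isInvertible_pullback_echart_symm hy).contDiffAt_map_inverse.comp y
    ((Ω.contDiffOn_pullback (isOpen_echart_target c) (contMDiffOn_echart_symm c)).contDiffAt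
      (echart_target_mem_nhds hy))

namespace IsHamiltonianFlow

theorem contDiffAt_chartHamiltonianField (hψ : Ω.IsHamiltonianFlow H ψ) {c : X}
    {z : ℝ × EuclideanSpace ℝ (Fin (2 * n))} (hz : z.2 ∈ (echart n c).target) :
    ContDiffAt ℝ ∞ (Ω.chartHamiltonianField H c) z := by
  have h1 : ContDiffAt ℝ ∞ (fun z : ℝ × EuclideanSpace ℝ (Fin (2 * n)) ↦
      (Ω.pullback (echart n c).symm z.2).inverse) z :=
    (contDiffAt_pullback_inverse hz).comp z contDiffAt_snd
  have h2 : ContDiffAt ℝ ∞ (fun z : ℝ × EuclideanSpace ℝ (Fin (2 * n)) ↦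
      H z.1 ((echart n c).symm z.2)) z :=
    ((contMDiffOn_prod_echart_symm hψ.contMDiff_hamiltonian c).contDiffOn).contDiffAt
      ((isOpen_univ_prod_echart_target ℝ c).mem_nhds ⟨mem_univ _, hz⟩)
  have h3 := h2.fderiv_right (m := ∞) (by simp)
  exact h1.clm_apply (h3.clm_comp contDiffAt_const).neg

/-- Nondegeneracy lets Hamilton's equation be solved for the velocity, so trajectories satisfy a
smooth ODE in the chart. -/
theorem hasDerivAt_echart_comp (hψ : Ω.IsHamiltonianFlow H ψ) {c x : X} {t : ℝ}
    (ht : ψ t x ∈ (echart n c).source) :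
    HasDerivAt (fun τ ↦ echart n c (ψ τ x))
      (Ω.chartHamiltonianField H c (t, echart n c (ψ t x))) t := by
  have hcurve := (contMDiff_family_param hψ.contMDiff_flow x).contMDiffAt (x := t)
  set γ := echart n c ∘ (fun τ ↦ ψ τ x) with hγ
  have hγd : DifferentiableAt ℝ γ t :=
    (contDiffAt_echart_comp hcurve ht).differentiableAt (by simp)
  have hy : γ t ∈ (echart n c).target := (echart n c).map_source ht
  have hleft : (echart n c).symm (γ t) = ψ t x := (echart n c).left_inv ht
  have hsymm := mdifferentiableAt_echart_symm hy
  have hvel : ∀ w : TangentSpace (𝓡 (2 * n)) (ψ t x), Ω.toFun (ψ t x)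
      (mfderiv 𝓘(ℝ, ℝ) (𝓡 (2 * n)) ((echart n c).symm ∘ γ) t (1 : ℝ)) w
      = -(mfderiv (𝓡 (2 * n)) 𝓘(ℝ, ℝ) (H t) (ψ t x) w : ℝ) := by
    intro w
    have h := (eventuallyEq_echart_symm_comp (n := n) hcurve.continuousAt ht).mfderiv_eq
      (I := 𝓘(ℝ, ℝ)) (I' := 𝓡 (2 * n))
    rw [← hψ.hamilton t x w]
    exact congrArg (fun A : ℝ →L[ℝ] EuclideanSpace ℝ (Fin (2 * n)) ↦
      Ω.toFun (ψ t x) (A 1) w) h.symm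
  have hmf := mfderiv_comp t hsymm hγd.mdifferentiableAt
  rw [mfderiv_eq_fderiv] at hmf
  have hform : Ω.pullback (echart n c).symm (γ t) (deriv γ t) =
      -(fderiv ℝ (fun z : ℝ × EuclideanSpace ℝ (Fin (2 * n)) ↦
      H z.1 ((echart n c).symm z.2)) (t, γ t)).comp (ContinuousLinearMap.inr ℝ ℝ _) := by
    ext w
    have h2 : DifferentiableAt ℝ (fun z : ℝ × EuclideanSpace ℝ (Fin (2 * n)) ↦
        H z.1 ((echart n c).symm z.2)) (t, γ t) :=
      (((contMDiffOn_prod_echart_symm hψ.contMDiff_hamiltonian c).contDiffOn).contDiffAt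
        ((isOpen_univ_prod_echart_target ℝ c).mem_nhds ⟨mem_univ _, hy⟩)).differentiableAt (by simp)
    have h3 := (h2.hasFDerivAt.comp (γ t) (hasFDerivAt_prodMk_right t (γ t))).fderiv
    have hHt : MDifferentiableAt (𝓡 (2 * n)) 𝓘(ℝ, ℝ) (H t) ((echart n c).symm (γ t)) :=
      (hψ.contMDiff_hamiltonian.comp (contMDiff_const.prodMk contMDiff_id)).mdifferentiableAt
        (by simp)
    have h4 := mfderiv_comp (γ t) hHt hsymm
    rw [mfderiv_eq_fderiv] at h4
    have e := congrArg (fun A ↦ A w) (h4.symm.trans h3)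
    have key : ∀ w : TangentSpace (𝓡 (2 * n)) ((echart n c).symm (γ t)),
        Ω.toFun ((echart n c).symm (γ t))
        (mfderiv 𝓘(ℝ, ℝ) (𝓡 (2 * n)) ((echart n c).symm ∘ γ) t (1 : ℝ)) w
        = -(mfderiv (𝓡 (2 * n)) 𝓘(ℝ, ℝ) (H t) ((echart n c).symm (γ t)) w : ℝ) := by
      rw [hleft]
      exact hvel
    have k1 := key (mfderiv 𝓘(ℝ, EuclideanSpace ℝ (Fin (2 * n))) (𝓡 (2 * n))
      (echart n c).symm (γ t) w)
    rw [hmf] at k1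
    exact k1.trans (congrArg Neg.neg e)
  have hfin : deriv γ t = Ω.chartHamiltonianField H c (t, γ t) := by
    rw [chartHamiltonianField, ← hform]
    exact ((Ω.isInvertible_pullback_echart_symm hy).inverse_apply_eq.2 rfl).symm
  have := hγd.hasDerivAt
  rw [hfin] at this
  exact this

/-- The times at which two trajectories agree form a closed set, open by uniqueness for the chart
ODE. If it is nonempty it contains `0`, where the flow is the identity. -/
theorem injective [T2Space X] (hψ : Ω.IsHamiltonianFlow H ψ) (t : ℝ) :
    Function.Injective (ψ t) := by
  intro x y hxy
  have hcont : ∀ x, Continuous (fun τ ↦ ψ τ x) := fun x ↦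
    (contMDiff_family_param hψ.contMDiff_flow x).continuous
  have hclosed : IsClosed {τ | ψ τ x = ψ τ y} := isClosed_eq (hcont x) (hcont y)
  have hopen : IsOpen {τ | ψ τ x = ψ τ y} := by
    rw [isOpen_iff_mem_nhds]
    intro t₀ ht₀
    set c := ψ t₀ x with hc
    have hcy : ψ t₀ y = c := Eq.symm ht₀
    have hcs : c ∈ (echart n c).source := mem_extChartAt_source c
    obtain ⟨K, s, hs, hLip⟩ := ((hψ.contDiffAt_chartHamiltonianField (c := c)
      (z := (t₀, echart n c c)) ((echart n c).map_source hcs)).of_le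
        (m := 1) (by simp)).exists_lipschitzOnWith
    have hsrc : (echart n c).source ∈ 𝓝 c := (isOpen_extChartAt_source c).mem_nhds hcs
    have hev : ∀ x', ψ t₀ x' = c → ∀ᶠ τ in 𝓝 t₀, ψ τ x' ∈ (echart n c).source ∧
        (HasDerivAt (fun τ ↦ echart n c (ψ τ x'))
          (Ω.chartHamiltonianField H c (τ, echart n c (ψ τ x'))) τ ∧
        echart n c (ψ τ x') ∈ {y | (τ, y) ∈ s}) := by
      intro x' hx'
      have h1 : ∀ᶠ τ in 𝓝 t₀, ψ τ x' ∈ (echart n c).source :=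
        (hcont x').continuousAt.preimage_mem_nhds (by rw [hx']; exact hsrc)
      have h2 : ContinuousAt (fun τ ↦ (τ, echart n c (ψ τ x'))) t₀ := by
        refine continuousAt_id.prodMk ?_
        exact ContinuousAt.comp (g := echart n c) (by
          rw [hx']; exact continuousAt_extChartAt c) (hcont x').continuousAt
      have h3 : ∀ᶠ τ in 𝓝 t₀, (τ, echart n c (ψ τ x')) ∈ s :=
        h2.preimage_mem_nhds (by rw [hx']; exact hs)
      filter_upwards [h1, h3] with τ hτ1 hτ3
      exact ⟨hτ1, hψ.hasDerivAt_echart_comp hτ1, hτ3⟩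
    have hL : ∀ᶠ τ in 𝓝 t₀, LipschitzOnWith K
        (fun y ↦ Ω.chartHamiltonianField H c (τ, y)) {y | (τ, y) ∈ s} := by
      refine Eventually.of_forall fun τ a ha b hb ↦ ?_
      refine (hLip ha hb).trans ?_
      simp [Prod.edist_eq]
    have heq := ODE_solution_unique_of_eventually hL ((hev x rfl).mono fun τ h ↦ h.2)
      ((hev y hcy).mono fun τ h ↦ h.2) (by simp only [hcy]; rfl)
    filter_upwards [heq, hev x rfl, hev y hcy] with τ h1 h2 h3
    exact (echart n c).injOn h2.1 h3.1 h1
  have huniv := IsClopen.eq_univ ⟨hclosed, hopen⟩ ⟨t, hxy⟩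
  have h0 : (0 : ℝ) ∈ {τ | ψ τ x = ψ τ y} := huniv ▸ mem_univ _
  simpa only [Set.mem_ofPred_eq, hψ.zero] using h0

end IsHamiltonianFlow

theorem isSymplecticMap_of_mem_ham {φ : X → X} (hφ : φ ∈ Ω.Ham) : Ω.IsSymplecticMap φ := by
  obtain ⟨H, ψ, hψ, rfl⟩ := hφ
  exact hψ.isSymplecticMap 1

theorem injective_of_mem_ham [T2Space X] {φ : X → X} (hφ : φ ∈ Ω.Ham) :
    Function.Injective φ := by
  obtain ⟨H, ψ, hψ, rfl⟩ := hφ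
  exact hψ.injective 1

end SymplecticForm

end Injective

/-! ### The top exterior power transforms by the determinant. -/

section WedgePower

variable {V : Type*} [NormedAddCommGroup V] [NormedSpace ℝ V]

/-- The slot `j` occurs in exactly one factor, the pair number `j / 2`; the other factors are
constant, and the parity of `j` tells which argument varies. -/
theorem prod_pairs_update {n : ℕ} (B : V →L[ℝ] V →L[ℝ] ℝ) (v : Fin (2 * n) → V)
    (j : Fin (2 * n)) :
    ∃ L : V →ₗ[ℝ] ℝ, ∀ x, ∏ i : Fin n, B (Function.update v j x ⟨2 * i, by omega⟩)
      (Function.update v j x ⟨2 * i + 1, by omega⟩) = L x := by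
  set k : Fin n := ⟨j / 2, by omega⟩ with hk
  set R := ∏ i ∈ Finset.univ.erase k, B (v ⟨2 * i, by omega⟩) (v ⟨2 * i + 1, by omega⟩) with hR
  have hrest : ∀ x, ∏ i ∈ Finset.univ.erase k, B (Function.update v j x ⟨2 * i, by omega⟩)
      (Function.update v j x ⟨2 * i + 1, by omega⟩) = R := by
    intro x
    refine Finset.prod_congr rfl fun i hi ↦ ?_
    have hik : (i : ℕ) ≠ j / 2 := fun h ↦ (Finset.mem_erase.1 hi).1 (Fin.ext h)
    rw [Function.update_of_ne, Function.update_of_ne]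
    · intro h
      have := congrArg Fin.val h
      simp only at this
      omega
    · intro h
      have := congrArg Fin.val h
      simp only at this
      omega
  rcases Nat.even_or_odd' j.val with ⟨m, hm | hm⟩
  · refine ⟨R • ((B.flip (v ⟨2 * k + 1, by omega⟩) : V →L[ℝ] ℝ) : V →ₗ[ℝ] ℝ), fun x ↦ ?_⟩
    rw [← Finset.mul_prod_erase _ _ (Finset.mem_univ k), hrest]
    have h1 : (⟨2 * k, by omega⟩ : Fin (2 * n)) = j := Fin.ext (by simp only [hk]; omega)
    have h2 : (⟨2 * k + 1, by omega⟩ : Fin (2 * n)) ≠ j := fun h ↦ by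
      have := congrArg Fin.val h
      simp only [hk] at this
      omega
    rw [Function.update_of_ne h2, h1, Function.update_self]
    simp [mul_comm]
  · refine ⟨R • ((B (v ⟨2 * k, by omega⟩) : V →L[ℝ] ℝ) : V →ₗ[ℝ] ℝ), fun x ↦ ?_⟩
    rw [← Finset.mul_prod_erase _ _ (Finset.mem_univ k), hrest]
    have h1 : (⟨2 * k + 1, by omega⟩ : Fin (2 * n)) = j := Fin.ext (by simp only [hk]; omega)
    have h2 : (⟨2 * k, by omega⟩ : Fin (2 * n)) ≠ j := fun h ↦ by
      have := congrArg Fin.val h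
      simp only [hk] at this
      omega
    rw [Function.update_of_ne h2, h1, Function.update_self]
    simp [mul_comm]

/-- The multilinear map `∏ B (v₂ᵢ, v₂ᵢ₊₁)`. -/
noncomputable def prodPairs (n : ℕ) (B : V →L[ℝ] V →L[ℝ] ℝ) :
    MultilinearMap ℝ (fun _ : Fin (2 * n) ↦ V) ℝ where
  toFun v := ∏ i : Fin n, B (v ⟨2 * i, by omega⟩) (v ⟨2 * i + 1, by omega⟩)
  map_update_add' {inst} v j x y := by
    obtain rfl : inst = instDecidableEqFin _ := Subsingleton.elim _ _
    obtain ⟨L, hL⟩ := prod_pairs_update B v j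
    rw [hL, hL, hL, map_add]
  map_update_smul' {inst} v j a x := by
    obtain rfl : inst = instDecidableEqFin _ := Subsingleton.elim _ _
    obtain ⟨L, hL⟩ := prod_pairs_update B v j
    rw [hL, hL, map_smul]

theorem wedgePower_eq_alternatization (n : ℕ) (B : V →L[ℝ] V →L[ℝ] ℝ) (v : Fin (2 * n) → V) :
    wedgePower n (fun x y ↦ B x y) v
      = ((1 / 2 ^ n : ℝ) • MultilinearMap.alternatization (prodPairs n B)) v := by
  rw [AlternatingMap.smul_apply, MultilinearMap.alternatization_apply, wedgePower, smul_eq_mul]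
  congr 1
  refine Finset.sum_congr rfl fun σ _ ↦ ?_
  rw [Units.smul_def, zsmul_eq_mul]
  rfl

/-- Alternating forms of top degree are multiples of `e.det`. -/
theorem wedgePower_comp_basis {n : ℕ} (B : V →L[ℝ] V →L[ℝ] ℝ) (A : V →L[ℝ] V)
    (e : Module.Basis (Fin (2 * n)) ℝ V) :
    wedgePower n (fun x y ↦ B (A x) (A y)) e = A.det * wedgePower n (fun x y ↦ B x y) e := by
  have h : wedgePower n (fun x y ↦ B (A x) (A y)) e
      = wedgePower n (fun x y ↦ B x y) (A ∘ e) := rfl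
  rw [h, wedgePower_eq_alternatization, wedgePower_eq_alternatization]
  set f := (1 / 2 ^ n : ℝ) • MultilinearMap.alternatization (prodPairs n B)
  rw [f.eq_smul_basis_det e]
  simp only [AlternatingMap.smul_apply, smul_eq_mul]
  have h2 : e.det (A ∘ e) = A.det * e.det e := Module.Basis.det_comp e (A : V →ₗ[ℝ] V) e
  rw [h2, e.det_self]
  ring

end WedgePower

/-! ### The volume measure, and its invariance under injective symplectic maps. -/

section Cover

variable {α : Type*} [MeasurableSpace α]

/-- Disjointing the cover cuts any measurable set into countably many pieces on which the inequality
is known. -/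
theorem measure_le_of_cover {μ ν : Measure α} {s : ℕ → Set α} (hs : ∀ i, MeasurableSet (s i))
    (hcover : ⋃ i, s i = univ) (h : ∀ i A, MeasurableSet A → A ⊆ s i → ν A ≤ μ A) : ν ≤ μ := by
  refine Measure.le_iff.2 fun A hA ↦ ?_
  have hd : ∀ i, MeasurableSet (A ∩ disjointed s i) := fun i ↦
    hA.inter (MeasurableSet.disjointed hs i)
  have hdisj : Pairwise (Function.onFun Disjoint fun i ↦ A ∩ disjointed s i) := fun i j hij ↦
    (disjoint_disjointed s hij).mono inter_subset_right inter_subset_right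
  have hU : A = ⋃ i, A ∩ disjointed s i := by
    rw [← inter_iUnion, iUnion_disjointed, hcover, inter_univ]
  rw [hU, measure_iUnion hdisj hd, measure_iUnion hdisj hd]
  exact ENNReal.tsum_le_tsum fun i ↦
    h i _ (hd i) (inter_subset_right.trans (disjointed_subset s i))

end Cover

section Volume

variable {n : ℕ} {X : Type*} [TopologicalSpace X]
  [ChartedSpace (EuclideanSpace ℝ (Fin (2 * n))) X] [IsManifold (𝓡 (2 * n)) ∞ X]

namespace SymplecticForm

variable (Ω : SymplecticForm n X)

/-- The signed density of `Ω^n` in the chart around `c`. -/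
noncomputable def chartDensity (c : X) (y : EuclideanSpace ℝ (Fin (2 * n))) : ℝ :=
  wedgePower n (formInChart Ω.toFun c y) (fun i ↦ EuclideanSpace.single i (1 : ℝ))

theorem continuousOn_chartDensity (c : X) :
    ContinuousOn (Ω.chartDensity c) (echart n c).target := by
  have h : ∀ v w, ContinuousOn (fun y ↦ formInChart Ω.toFun c y v w) (echart n c).target :=
    fun v w ↦ (Ω.contDiffOn_pullback_apply (isOpen_echart_target c)
      (contMDiffOn_echart_symm c) v w).continuousOn
  unfold chartDensity wedgePower
  exact continuousOn_const.mul (continuousOn_finsetSum _ fun σ _ ↦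
    continuousOn_const.mul (continuousOn_finsetProd _ fun i _ ↦ h _ _))

variable {Ω} in
theorem IsSymplecticMap.pullback_echart_symm {φ : X → X} (hφ : Ω.IsSymplecticMap φ) {c c' : X}
    {y : EuclideanSpace ℝ (Fin (2 * n))} (hy : y ∈ (echart n c).target)
    (hc' : φ ((echart n c).symm y) ∈ (echart n c').source)
    (v w : EuclideanSpace ℝ (Fin (2 * n))) :
    Ω.pullback (echart n c).symm y v w
      = Ω.pullback (echart n c').symm (echart n c' (φ ((echart n c).symm y)))
        (fderiv ℝ (echart n c' ∘ (φ ∘ (echart n c).symm)) y v)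
        (fderiv ℝ (echart n c' ∘ (φ ∘ (echart n c).symm)) y w) := by
  have hG : ContMDiffAt 𝓘(ℝ, EuclideanSpace ℝ (Fin (2 * n))) (𝓡 (2 * n)) ∞
      (φ ∘ (echart n c).symm) y :=
    hφ.contMDiff.contMDiffAt.comp y
      ((contMDiffOn_echart_symm c).contMDiffAt (echart_target_mem_nhds hy))
  refine Eq.trans ?_ (Ω.pullback_eq_chart hG hc' v w)
  rw [pullback_apply, pullback_apply,
    mfderiv_comp y (hφ.contMDiff.mdifferentiableAt (by simp)) (mdifferentiableAt_echart_symm hy)]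
  exact (hφ.map_form _ _ _).symm

variable {Ω} in
theorem IsSymplecticMap.chartDensity_eq {φ : X → X} (hφ : Ω.IsSymplecticMap φ) {c c' : X}
    {y : EuclideanSpace ℝ (Fin (2 * n))} (hy : y ∈ (echart n c).target)
    (hc' : φ ((echart n c).symm y) ∈ (echart n c').source) :
    Ω.chartDensity c y = (fderiv ℝ (echart n c' ∘ (φ ∘ (echart n c).symm)) y).det
      * Ω.chartDensity c' (echart n c' (φ ((echart n c).symm y))) := by
  set e : Module.Basis (Fin (2 * n)) ℝ (EuclideanSpace ℝ (Fin (2 * n))) :=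
    (EuclideanSpace.basisFun (Fin (2 * n)) ℝ).toBasis
  have he : (fun i ↦ EuclideanSpace.single i (1 : ℝ)) = e := by
    funext i
    simp [e]
  have h := wedgePower_comp_basis
    (Ω.pullback (echart n c').symm (echart n c' (φ ((echart n c).symm y))))
    (fderiv ℝ (echart n c' ∘ (φ ∘ (echart n c).symm)) y) e
  unfold chartDensity
  rw [he]
  refine Eq.trans ?_ h
  congr 1
  funext v w
  exact hφ.pullback_echart_symm hy hc' v w

variable [MeasurableSpace X] [BorelSpace X]

/-- The measure defined by `Ω^n` in the chart around `c`. -/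
noncomputable def chartMeasure (c : X) : Measure X :=
  Measure.map (echart n c).symm ((volume.restrict (echart n c).target).withDensity fun y ↦
      ENNReal.ofReal |Ω.chartDensity c y|)

omit [BorelSpace X] in
theorem volumeMeasure_eq_iSup : Ω.volumeMeasure = ⨆ c, Ω.chartMeasure c := rfl

theorem measurableSet_target_inter_preimage (c : X) {A : Set X} (hA : MeasurableSet A) :
    MeasurableSet ((echart n c).symm ⁻¹' A ∩ (echart n c).target) := by
  have h : Measurable ((echart n c).target.domRestrict (echart n c).symm) :=
    (continuousOn_iff_continuous_domRestrict.1 (contMDiffOn_echart_symm c).continuousOn).measurable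
  have h2 := (isOpen_echart_target c).measurableSet.subtype_image (h hA)
  convert h2 using 1
  ext y
  constructor
  · rintro ⟨h1, h2⟩
    exact ⟨⟨y, h2⟩, h1, rfl⟩
  · rintro ⟨⟨z, hz⟩, h1, rfl⟩
    exact ⟨h1, hz⟩

theorem chartMeasure_apply (c : X) {A : Set X} (hA : MeasurableSet A) :
    Ω.chartMeasure c A = ∫⁻ y in (echart n c).symm ⁻¹' A ∩ (echart n c).target,
      ENNReal.ofReal |Ω.chartDensity c y| := by
  have hT := (isOpen_echart_target (n := n) c).measurableSet
  have hae : AEMeasurable (echart n c).symm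
      ((volume.restrict (echart n c).target).withDensity fun y ↦
      ENNReal.ofReal |Ω.chartDensity c y|) :=
    ((contMDiffOn_echart_symm c).continuousOn.aemeasurable hT).mono_ac
      (withDensity_absolutelyContinuous _ _)
  rw [chartMeasure, Measure.map_apply_of_aemeasurable hae hA, withDensity_apply',
    Measure.restrict_restrict' hT]

variable {Ω} in
-- Change of variables in charts, the Jacobian being absorbed by the density. Only an inequality can
-- hold, since the chart around `c` need not cover the preimage of `A`.
theorem IsSymplecticMap.chartMeasure_preimage_le [T2Space X] {φ : X → X}
    (hφ : Ω.IsSymplecticMap φ) (hinj : Function.Injective φ) (c c' : X) {A : Set X}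
    (hA : MeasurableSet A) (hAc : A ⊆ (echart n c').source) :
    Ω.chartMeasure c (φ ⁻¹' A) ≤ Ω.chartMeasure c' A := by
  rw [Ω.chartMeasure_apply c (hφ.contMDiff.continuous.measurable hA), Ω.chartMeasure_apply c' hA]
  set B := (echart n c).symm ⁻¹' (φ ⁻¹' A) ∩ (echart n c).target with hBdef
  have hB : MeasurableSet B :=
    measurableSet_target_inter_preimage c (hφ.contMDiff.continuous.measurable hA)
  set T := echart n c' ∘ (φ ∘ (echart n c).symm) with hTdef
  have hTd : ∀ y ∈ B, HasFDerivWithinAt T (fderiv ℝ T y) B y := by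
    intro y hy
    have hG : ContMDiffAt 𝓘(ℝ, EuclideanSpace ℝ (Fin (2 * n))) (𝓡 (2 * n)) ∞
        (φ ∘ (echart n c).symm) y :=
      hφ.contMDiff.contMDiffAt.comp y
        ((contMDiffOn_echart_symm c).contMDiffAt (echart_target_mem_nhds hy.2))
    exact ((contDiffAt_echart_comp hG (hAc hy.1)).differentiableAt
      (by simp)).hasFDerivAt.hasFDerivWithinAt
  have hTinj : InjOn T B := by
    intro y hy z hz hyz
    exact (echart n c).symm.injOn hy.2 hz.2
      (hinj ((echart n c').injOn (hAc hy.1) (hAc hz.1) hyz))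
  calc ∫⁻ y in B, ENNReal.ofReal |Ω.chartDensity c y|
      = ∫⁻ y in B, ENNReal.ofReal |(fderiv ℝ T y).det|
          * ENNReal.ofReal |Ω.chartDensity c' (T y)| := by
        refine setLIntegral_congr_fun hB fun y hy ↦ ?_
        rw [← ENNReal.ofReal_mul (abs_nonneg _), ← abs_mul]
        beta_reduce
        rw [hφ.chartDensity_eq hy.2 (hAc hy.1)]
        rfl
    _ = ∫⁻ z in T '' B, ENNReal.ofReal |Ω.chartDensity c' z| :=
        (lintegral_image_eq_lintegral_abs_det_fderiv_mul volume hB hTd hTinj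
          (fun z ↦ ENNReal.ofReal |Ω.chartDensity c' z|)).symm
    _ ≤ _ := by
        refine lintegral_mono_set ?_
        rintro _ ⟨y, hy, rfl⟩
        refine ⟨?_, (echart n c').map_source (hAc hy.1)⟩
        have : (echart n c').symm (T y) = φ ((echart n c).symm y) :=
          (echart n c').left_inv (hAc hy.1)
        rw [mem_preimage, this]
        exact hy.1

omit [MeasurableSpace X] [BorelSpace X] in
theorem isSymplecticMap_id : Ω.IsSymplecticMap id := by
  refine ⟨contMDiff_id, fun x v w ↦ ?_⟩
  rw [mfderiv_id]
  rfl

omit [IsManifold (𝓡 (2 * n)) ∞ X] [MeasurableSpace X] [BorelSpace X] in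
variable (n X) in
theorem exists_seq_echart_source_cover [CompactSpace X] [Nonempty X] :
    ∃ c : ℕ → X, ⋃ i, (echart n (c i)).source = univ := by
  obtain ⟨t, ht⟩ := isCompact_univ.elim_nhds_subcover (fun c : X ↦ (echart n c).source)
    (fun c _ ↦ extChartAt_source_mem_nhds c)
  have htne : (t : Set X).Nonempty := by
    obtain ⟨x⟩ := ‹Nonempty X›
    obtain ⟨c, hc, -⟩ := mem_iUnion₂.1 (ht.2 (mem_univ x))
    exact ⟨c, hc⟩
  obtain ⟨c, hc⟩ := t.countable_toSet.exists_eq_range htne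
  refine ⟨c, eq_univ_of_univ_subset (ht.2.trans fun x hx ↦ ?_)⟩
  obtain ⟨a, ha, hx⟩ := mem_iUnion₂.1 hx
  obtain ⟨i, rfl⟩ := (hc ▸ ha : a ∈ range c)
  exact mem_iUnion.2 ⟨i, hx⟩

variable {Ω} in
theorem IsSymplecticMap.map_chartMeasure_le [T2Space X] [CompactSpace X] {φ : X → X}
    (hφ : Ω.IsSymplecticMap φ) (hinj : Function.Injective φ) (c : X) :
    Measure.map φ (Ω.chartMeasure c) ≤ Ω.volumeMeasure := by
  have : Nonempty X := ⟨c⟩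
  obtain ⟨d, hd⟩ := exists_seq_echart_source_cover n X
  refine measure_le_of_cover (fun i ↦ (isOpen_extChartAt_source (d i)).measurableSet) hd ?_
  intro i A hA hAi
  rw [Measure.map_apply hφ.contMDiff.continuous.measurable hA]
  exact (hφ.chartMeasure_preimage_le hinj c (d i) hA hAi).trans
    (Measure.le_iff'.1 (le_iSup Ω.chartMeasure (d i)) A)

/-- The comparison above with `φ = id` bounds every chart measure by one sum over finitely many
compact pieces, on which the densities are bounded. -/
theorem isFiniteMeasure_volumeMeasure [T2Space X] [CompactSpace X] :
    IsFiniteMeasure Ω.volumeMeasure := by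
  have hK : ∀ x : X, ∃ K ∈ 𝓝 x, K ⊆ (echart n x).source ∧ IsCompact K := fun x ↦
    local_compact_nhds (extChartAt_source_mem_nhds x)
  choose K hKn hKs hKc using hK
  obtain ⟨t, -, ht⟩ := isCompact_univ.elim_nhds_subcover K (fun c _ ↦ hKn c)
  have hle : Ω.volumeMeasure ≤ ∑ d ∈ t, (Ω.chartMeasure d).restrict (K d) := by
    rw [volumeMeasure_eq_iSup]
    refine iSup_le fun c ↦ Measure.le_iff.2 fun A hA ↦ ?_
    have hsub : A ⊆ ⋃ d ∈ t, A ∩ K d := fun x hx ↦ by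
      obtain ⟨d, hd, hxd⟩ := mem_iUnion₂.1 (ht (mem_univ x))
      exact mem_iUnion₂.2 ⟨d, hd, hx, hxd⟩
    refine (measure_mono hsub).trans ((measure_biUnion_finset_le t _).trans ?_)
    rw [Measure.finsetSum_apply]
    refine Finset.sum_le_sum fun d _ ↦ ?_
    rw [Measure.restrict_apply hA]
    exact Ω.isSymplecticMap_id.chartMeasure_preimage_le Function.injective_id c d
      (hA.inter (hKc d).measurableSet) (inter_subset_right.trans (hKs d))
  have hfin : ∀ d, Ω.chartMeasure d (K d) < ⊤ := by
    intro d
    rw [Ω.chartMeasure_apply d (hKc d).measurableSet]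
    have himg : (echart n d).symm ⁻¹' (K d) ∩ (echart n d).target = echart n d '' K d := by
      rw [inter_comm, (echart n d).image_eq_target_inter_inv_preimage (hKs d)]
    have hcomp : IsCompact (echart n d '' K d) :=
      (hKc d).image_of_continuousOn ((continuousOn_extChartAt d).mono (hKs d))
    rw [himg]
    have hcont : ContinuousOn (fun y ↦ |Ω.chartDensity d y|) (echart n d '' K d) := by
      refine (Ω.continuousOn_chartDensity d).abs.mono ?_
      rintro _ ⟨x, hx, rfl⟩
      exact (echart n d).map_source (hKs d hx)
    exact (hcont.integrableOn_compact hcomp).lintegral_lt_top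
  refine ⟨(Measure.le_iff'.1 hle univ).trans_lt ?_⟩
  rw [Measure.finsetSum_apply]
  refine ENNReal.sum_lt_top.2 fun d _ ↦ ?_
  rw [Measure.restrict_apply_univ]
  exact hfin d

variable {Ω} in
-- Comparing chart measures shows that `φ` does not decrease the volume of images, so the
-- pushforward is at most the volume. The total masses agree and are finite, hence the measures are
-- equal.
theorem IsSymplecticMap.measurePreserving [T2Space X] [CompactSpace X] {φ : X → X}
    (hφ : Ω.IsSymplecticMap φ) (hinj : Function.Injective φ) :
    MeasurePreserving φ Ω.volumeMeasure Ω.volumeMeasure := by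
  have := Ω.isFiniteMeasure_volumeMeasure
  have hemb : MeasurableEmbedding φ :=
    (hφ.contMDiff.continuous.isClosedEmbedding hinj).measurableEmbedding
  refine ⟨hemb.measurable, ?_⟩
  have hle : Ω.volumeMeasure ≤ Measure.comap φ Ω.volumeMeasure := by
    conv_lhs => rw [volumeMeasure_eq_iSup]
    refine iSup_le fun c ↦ Measure.le_iff.2 fun S hS ↦ ?_
    rw [hemb.comap_apply]
    have h := Measure.le_iff'.1 (hφ.map_chartMeasure_le hinj c) (φ '' S)
    rwa [hemb.map_apply, preimage_image_eq _ hinj] at h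
  refine Measure.eq_of_le_of_measure_univ_eq (Measure.le_iff.2 fun A hA ↦ ?_) ?_
  · rw [hemb.map_apply]
    refine (Measure.le_iff'.1 hle _).trans ?_
    rw [hemb.comap_apply]
    exact measure_mono (image_preimage_subset φ A)
  · rw [hemb.map_apply, preimage_univ]

end SymplecticForm

end Volume

/-! ### Smooth inverses of symplectic maps. -/

theorem isInvertible_of_injective {E : Type*} [NormedAddCommGroup E] [NormedSpace ℝ E]
    [FiniteDimensional ℝ E] (A : E →L[ℝ] E) (hA : ∀ v, A v = 0 → v = 0) : A.IsInvertible := by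
  have hinj : Function.Injective (A : E →ₗ[ℝ] E) := by
    rw [← LinearMap.ker_eq_bot, LinearMap.ker_eq_bot']
    exact hA
  exact ⟨(LinearMap.linearEquivOfInjective _ hinj rfl).toContinuousLinearEquiv, by ext; rfl⟩

section Inverse

variable {n : ℕ} {X : Type*} [TopologicalSpace X]
  [ChartedSpace (EuclideanSpace ℝ (Fin (2 * n))) X] [IsManifold (𝓡 (2 * n)) ∞ X]

namespace SymplecticForm

variable {Ω : SymplecticForm n X} {φ : X → X}

namespace IsSymplecticMap

/-- A map preserving a nondegenerate form has injective differential; the inverse function theorem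
applies to its chart expression. -/
theorem exists_contMDiffAt_right_inverse (hφ : Ω.IsSymplecticMap φ) (x : X) :
    ∃ g : X → X, ContMDiffAt (𝓡 (2 * n)) (𝓡 (2 * n)) ∞ g (φ x) ∧
      ∀ᶠ q in 𝓝 (φ x), φ (g q) = q := by
  have hx : x ∈ (echart n x).source := mem_extChartAt_source x
  have hy := (echart n x).map_source hx
  have hleft : (echart n x).symm (echart n x x) = x := (echart n x).left_inv hx
  set y := echart n x x with hydef
  set c' := φ x with hc'def
  have hc's : c' ∈ (echart n c').source := mem_extChartAt_source c'
  have hc' : φ ((echart n x).symm y) ∈ (echart n c').source := by rw [hleft]; exact hc's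
  set T := echart n c' ∘ (φ ∘ (echart n x).symm) with hT
  have hG : ContMDiffAt 𝓘(ℝ, EuclideanSpace ℝ (Fin (2 * n))) (𝓡 (2 * n)) ∞
      (φ ∘ (echart n x).symm) y :=
    hφ.contMDiff.contMDiffAt.comp y
      ((contMDiffOn_echart_symm x).contMDiffAt (echart_target_mem_nhds hy))
  have hTs : ContDiffAt ℝ ∞ T y := contDiffAt_echart_comp hG hc'
  have hTy : T y = echart n c' c' := by simp only [hT, Function.comp, hleft]; rfl
  obtain ⟨A, hA⟩ : (fderiv ℝ T y).IsInvertible := by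
    refine isInvertible_of_injective _ fun v hv ↦ ?_
    refine mfderiv_echart_symm_injective hy (Ω.nondegenerate' _ _ fun w ↦ ?_)
    obtain ⟨d, rfl⟩ := exists_mfderiv_echart_symm_eq hy w
    refine (hφ.pullback_echart_symm hy hc' v d).trans ?_
    have : fderiv ℝ (echart n c' ∘ (φ ∘ (echart n x).symm)) y v = 0 := hv
    rw [this, map_zero]
    rfl
  have hTd : HasFDerivAt T (A : _ →L[ℝ] _) y := by
    rw [hA]
    exact (hTs.differentiableAt (by simp)).hasFDerivAt
  set L := hTs.localInverse hTd (by simp) with hL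
  have hLs : ContDiffAt ℝ ∞ L (T y) := hTs.to_localInverse hTd (by simp)
  have hLy : L (T y) = y := hTs.localInverse_apply_image hTd (by simp)
  have hTL : ∀ᶠ z in 𝓝 (T y), T (L z) = z :=
    (hTs.hasStrictFDerivAt' hTd (by simp)).eventually_right_inverse
  have hchart : ContinuousAt (echart n c') c' := continuousAt_extChartAt c'
  have hg1 : ContMDiffAt (𝓡 (2 * n)) (𝓡 (2 * n)) ∞
      ((echart n x).symm ∘ (L ∘ echart n c')) c' := by
    have h1 : ContMDiffAt (𝓡 (2 * n)) 𝓘(ℝ, EuclideanSpace ℝ (Fin (2 * n))) ∞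
        (L ∘ echart n c') c' :=
      ContMDiffAt.comp (g := L) c' (by rw [← hTy]; exact hLs.contMDiffAt) (contMDiffAt_echart hc's)
    refine ContMDiffAt.comp (g := (echart n x).symm) c' ?_ h1
    have : (L ∘ echart n c') c' = y := by rw [Function.comp, ← hTy, hLy]
    rw [this]
    exact (contMDiffOn_echart_symm x).contMDiffAt (echart_target_mem_nhds hy)
  refine ⟨_, hg1, ?_⟩
  have e1 : ∀ᶠ q in 𝓝 c', T (L (echart n c' q)) = echart n c' q :=
    hchart.eventually (by rw [← hTy]; exact hTL)
  have e2 : ∀ᶠ q in 𝓝 c', q ∈ (echart n c').source :=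
    (isOpen_extChartAt_source c').mem_nhds hc's
  have e3 : ∀ᶠ q in 𝓝 c',
      φ (((echart n x).symm ∘ (L ∘ echart n c')) q) ∈ (echart n c').source := by
    have hcont : ContinuousAt (φ ∘ ((echart n x).symm ∘ (L ∘ echart n c'))) c' :=
      ContinuousAt.comp hφ.contMDiff.continuous.continuousAt hg1.continuousAt
    refine hcont.preimage_mem_nhds ((isOpen_extChartAt_source c').mem_nhds ?_)
    simp only [Function.comp]
    rw [← hTy, hLy]
    exact hc'
  filter_upwards [e1, e2, e3] with q h1 h2 h3
  exact (echart n c').injOn h3 h2 h1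

/-- The image is closed by compactness and open by the local right inverses, so it is all of the
connected space. -/
theorem surjective [T2Space X] [CompactSpace X] [ConnectedSpace X] (hφ : Ω.IsSymplecticMap φ) :
    Function.Surjective φ := by
  rw [← range_eq_univ]
  refine IsClopen.eq_univ ⟨(isCompact_range hφ.contMDiff.continuous).isClosed, ?_⟩
    (range_nonempty φ)
  rw [isOpen_iff_mem_nhds]
  rintro _ ⟨x, rfl⟩
  obtain ⟨g, -, hg⟩ := hφ.exists_contMDiffAt_right_inverse x
  filter_upwards [hg] with q hq using ⟨g q, hq⟩

theorem exists_contMDiff_inverse [T2Space X] [CompactSpace X] [ConnectedSpace X]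
    (hφ : Ω.IsSymplecticMap φ) (hinj : Function.Injective φ) :
    ∃ g : X → X, ContMDiff (𝓡 (2 * n)) (𝓡 (2 * n)) ∞ g ∧ ∀ x, g (φ x) = x := by
  have hsurj := hφ.surjective
  refine ⟨Function.surjInv hsurj, fun z ↦ ?_, fun x ↦
    hinj (Function.surjInv_eq hsurj (φ x))⟩
  obtain ⟨x, rfl⟩ := hsurj z
  obtain ⟨g, hgs, hg⟩ := hφ.exists_contMDiffAt_right_inverse x
  refine hgs.congr_of_eventuallyEq ?_
  filter_upwards [hg] with q hq
  exact hinj ((Function.surjInv_eq hsurj q).trans hq.symm)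

theorem mfderiv_injective (hφ : Ω.IsSymplecticMap φ) {x : X}
    {v : TangentSpace (𝓡 (2 * n)) x} (hv : mfderiv (𝓡 (2 * n)) (𝓡 (2 * n)) φ x v = 0) :
    v = 0 := by
  refine Ω.nondegenerate' x v fun w ↦ ?_
  rw [← hφ.map_form, hv, map_zero]
  rfl

theorem mfderiv_surjective (hφ : Ω.IsSymplecticMap φ) (x : X)
    (w : TangentSpace (𝓡 (2 * n)) (φ x)) :
    ∃ v, mfderiv (𝓡 (2 * n)) (𝓡 (2 * n)) φ x v = w := by
  obtain ⟨A, hA⟩ := isInvertible_of_injective (E := EuclideanSpace ℝ (Fin (2 * n)))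
    (by exact mfderiv (𝓡 (2 * n)) (𝓡 (2 * n)) φ x) fun v hv ↦ hφ.mfderiv_injective hv
  refine ⟨A.symm w, ?_⟩
  exact (congrArg (fun B ↦ B (A.symm w)) hA.symm).trans (A.apply_symm_apply w)

end IsSymplecticMap

end SymplecticForm

end Inverse

/-! ### Integrals with parameters and integrals over the square. -/

section Analysis

theorem hasDerivAt_setIntegral_of_continuousOn {α : Type*} [TopologicalSpace α] [T2Space α]
    [MeasurableSpace α] [OpensMeasurableSpace α] (ν : Measure α) [IsFiniteMeasureOnCompacts ν]
    {F : Type*} [NormedAddCommGroup F] [NormedSpace ℝ F]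
    {K : Set α} (hK : IsCompact K) {J J' : ℝ → α → F} {r₀ ε : ℝ} (hε : 0 < ε)
    (hJ : ∀ r ∈ Metric.closedBall r₀ ε, ContinuousOn (J r) K)
    (hJ' : ContinuousOn (fun z : ℝ × α ↦ J' z.1 z.2) (Metric.closedBall r₀ ε ×ˢ K))
    (hder : ∀ r ∈ Metric.closedBall r₀ ε, ∀ q ∈ K, HasDerivAt (fun r ↦ J r q) (J' r q) r) :
    HasDerivAt (fun r ↦ ∫ q in K, J r q ∂ν) (∫ q in K, J' r₀ q ∂ν) r₀ := by
  obtain ⟨C, hC⟩ := ((isCompact_closedBall r₀ ε).prod hK).exists_bound_of_continuousOn hJ'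
  have hint : ∀ r ∈ Metric.closedBall r₀ ε, IntegrableOn (J r) K ν := fun r hr ↦
    (hJ r hr).integrableOn_compact hK
  have hr₀ : r₀ ∈ Metric.closedBall r₀ ε := Metric.mem_closedBall_self hε.le
  have hJ'0 : ContinuousOn (J' r₀) K :=
    hJ'.comp (Continuous.prodMk_right r₀).continuousOn fun q hq ↦ ⟨hr₀, hq⟩
  refine (hasDerivAt_integral_of_dominated_loc_of_deriv_le (bound := fun _ ↦ C)
    (Metric.closedBall_mem_nhds r₀ hε) ?_ (hint r₀ hr₀)
    (hJ'0.integrableOn_compact hK).aestronglyMeasurable ?_ ?_ ?_).2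
  · filter_upwards [Metric.closedBall_mem_nhds r₀ hε] with r hr
    exact (hint r hr).aestronglyMeasurable
  · filter_upwards [ae_restrict_mem hK.measurableSet] with q hq r hr
    exact hC (r, q) ⟨hr, hq⟩
  · exact integrableOn_const hK.measure_lt_top.ne
  · filter_upwards [ae_restrict_mem hK.measurableSet] with q hq r hr
    exact hder r hr q hq

theorem integral_setIntegral_eq_zero {α Y : Type*} [TopologicalSpace α] [T2Space α]
    [SecondCountableTopology α] [MeasurableSpace α] [BorelSpace α] (ν : Measure α)
    [IsFiniteMeasureOnCompacts ν] [SFinite ν]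
    [TopologicalSpace Y] [CompactSpace Y] [T2Space Y] [SecondCountableTopology Y]
    [MeasurableSpace Y] [BorelSpace Y] (μ : Measure Y) [IsFiniteMeasure μ]
    {K : Set α} (hK : IsCompact K) {Φ : α → Y → ℝ} (hΦ : Continuous fun z : α × Y ↦ Φ z.1 z.2)
    (h0 : ∀ q ∈ K, ∫ y, Φ q y ∂μ = 0) : ∫ y, ∫ q in K, Φ q y ∂ν ∂μ = 0 := by
  have hint : Integrable (Function.uncurry fun y q ↦ Φ q y) (μ.prod (ν.restrict K)) := by
    have h1 : IntegrableOn (Function.uncurry fun y q ↦ Φ q y) (univ ×ˢ K) (μ.prod ν) :=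
      (ContinuousOn.integrableOn_compact (isCompact_univ.prod hK)
        (hΦ.comp continuous_swap).continuousOn)
    rwa [IntegrableOn, ← Measure.prod_restrict, Measure.restrict_univ] at h1
  rw [integral_integral_swap hint]
  exact (setIntegral_congr_fun hK.measurableSet h0).trans (integral_zero _ _)

theorem isCompact_unitSquare : IsCompact unitSquare := isCompact_Icc.prod isCompact_Icc

theorem setIntegral_unitSquare {φ : ℝ × ℝ → ℝ} (hφ : Continuous φ) :
    ∫ p in unitSquare, φ p = ∫ u in (0 : ℝ)..1, ∫ t in (0 : ℝ)..1, φ (u, t) := by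
  rw [unitSquare, Measure.volume_eq_prod, setIntegral_prod _ (by
    rw [← Measure.volume_eq_prod]
    exact hφ.continuousOn.integrableOn_compact isCompact_unitSquare)]
  simp only [intervalIntegral.integral_of_le zero_le_one, integral_Icc_eq_integral_Ioc]

theorem setIntegral_unitSquare_deriv_snd {φ φ' : ℝ × ℝ → ℝ} (hφ' : Continuous φ')
    (h : ∀ u t, HasDerivAt (fun t ↦ φ (u, t)) (φ' (u, t)) t) :
    ∫ p in unitSquare, φ' p = ∫ u in (0 : ℝ)..1, (φ (u, 1) - φ (u, 0)) := by
  rw [setIntegral_unitSquare hφ']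
  refine intervalIntegral.integral_congr fun u _ ↦ ?_
  exact intervalIntegral.integral_eq_sub_of_hasDerivAt (fun t _ ↦ h u t)
    ((hφ'.comp (Continuous.prodMk_right u)).intervalIntegrable _ _)

theorem setIntegral_unitSquare_deriv_fst {φ φ' : ℝ × ℝ → ℝ} (hφ' : Continuous φ')
    (h : ∀ u t, HasDerivAt (fun u ↦ φ (u, t)) (φ' (u, t)) u) :
    ∫ p in unitSquare, φ' p = ∫ t in (0 : ℝ)..1, (φ (1, t) - φ (0, t)) := by
  have hsw : ∫ p in unitSquare, φ' p = ∫ p in unitSquare, φ' p.swap := by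
    have hmp : MeasurePreserving (Prod.swap : ℝ × ℝ → ℝ × ℝ) volume volume := by
      rw [Measure.volume_eq_prod]
      exact Measure.measurePreserving_swap
    have h := hmp.setIntegral_preimage_emb MeasurableEquiv.prodComm.measurableEmbedding φ' unitSquare
    rw [← h]
    congr 2
    ext p
    simp [unitSquare]
  rw [hsw]
  exact setIntegral_unitSquare_deriv_snd (φ := fun p ↦ φ p.swap) (hφ'.comp continuous_swap)
    fun u t ↦ h t u

end Analysis

/-! ### The integration by parts behind the area formula. -/

section Area

variable {E : Type*} [NormedAddCommGroup E] [NormedSpace ℝ E] [CompleteSpace E]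

omit [CompleteSpace E] in
theorem hasDerivAt_intervalIntegral_param {J J' : ℝ × ℝ → E} (hJ : Continuous J)
    (hJ' : Continuous J') (h : ∀ u s, HasDerivAt (fun u ↦ J (u, s)) (J' (u, s)) u) (a b u : ℝ) :
    HasDerivAt (fun u ↦ ∫ s in a..b, J (u, s)) (∫ s in a..b, J' (u, s)) u := by
  have key : ∀ a b : ℝ, a ≤ b →
      HasDerivAt (fun u ↦ ∫ s in a..b, J (u, s)) (∫ s in a..b, J' (u, s)) u := by
    intro a b hab
    simp only [intervalIntegral.integral_of_le hab, ← integral_Icc_eq_integral_Ioc]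
    exact hasDerivAt_setIntegral_of_continuousOn volume isCompact_Icc
      (J := fun u s ↦ J (u, s)) (J' := fun u s ↦ J' (u, s)) one_pos
      (fun r _ ↦ (hJ.comp (Continuous.prodMk_right r)).continuousOn) hJ'.continuousOn
      fun r _ q _ ↦ h r q
  rcases le_total a b with hab | hab
  · exact key a b hab
  · simp only [intervalIntegral.integral_symm b a]
    exact (key b a hab).neg

theorem hasDerivAt_mk_left {F : Type*} [NormedAddCommGroup F] [NormedSpace ℝ F] {f : ℝ × ℝ → F}
    {u t : ℝ} (hf : DifferentiableAt ℝ f (u, t)) :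
    HasDerivAt (fun u ↦ f (u, t)) (fderiv ℝ f (u, t) (1, 0)) u :=
  hf.hasFDerivAt.comp_hasDerivAt u ((hasDerivAt_id u).prodMk (hasDerivAt_const u t))

theorem hasDerivAt_mk_right {F : Type*} [NormedAddCommGroup F] [NormedSpace ℝ F] {f : ℝ × ℝ → F}
    {u t : ℝ} (hf : DifferentiableAt ℝ f (u, t)) :
    HasDerivAt (fun t ↦ f (u, t)) (fderiv ℝ f (u, t) (0, 1)) t :=
  hf.hasFDerivAt.comp_hasDerivAt t ((hasDerivAt_const t u).prodMk (hasDerivAt_id t))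

/-- The symplectic area of a square whose partial derivatives `η`, `ξ` satisfy
`∂ᵤ ξ = ∂ₜ η - Z`, in terms of `Z`. -/
theorem two_mul_setIntegral_unitSquare {B : E →L[ℝ] E →L[ℝ] ℝ} (hB : ∀ v, B v v = 0)
    {ξ η Z : ℝ × ℝ → E} (hξ : ContDiff ℝ ∞ ξ) (hη : ContDiff ℝ ∞ η) (hZ : Continuous Z)
    (hcurv : ∀ p, fderiv ℝ ξ p (1, 0) = fderiv ℝ η p (0, 1) - Z p)
    (hξ0 : ∀ t, ξ (0, t) = 0) (hη0 : ∀ u, η (u, 0) = 0) (hη1 : ∀ u, η (u, 1) = 0)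
    {r : ℝ → ℝ} {e : E} (hξ1 : ∀ t, ξ (1, t) = r t • e) :
    2 * ∫ p in unitSquare, B (η p) (ξ p) = ∫ p in unitSquare, ∫ s in (0 : ℝ)..p.2,
      (B (Z (p.1, s)) (ξ p) - B (Z p) (ξ (p.1, s))) := by
  have hswap : ∀ v w, B v w = -B w v := by
    intro v w
    have h := hB (v + w)
    simp only [map_add, add_apply, hB] at h
    linarith
  have hξc := hξ.continuous
  have hηc := hη.continuous
  have hξd : Differentiable ℝ ξ := hξ.differentiable (by simp)
  have hηd : Differentiable ℝ η := hη.differentiable (by simp)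
  have hξu : Continuous fun p ↦ fderiv ℝ ξ p (1, 0) :=
    (hξ.continuous_fderiv (by simp)).clm_apply continuous_const
  have hηt : Continuous fun p ↦ fderiv ℝ η p (0, 1) :=
    (hη.continuous_fderiv (by simp)).clm_apply continuous_const
  -- `g` and `W` are the primitives of `ξ` and `Z` in `t`. Integrating the curvature equation from
  -- `t = 0`, where `η` vanishes, gives `∂ᵤ g = η - W`.
  set g : ℝ × ℝ → E := fun p ↦ ∫ s in (0 : ℝ)..p.2, ξ (p.1, s) with hg
  set W : ℝ × ℝ → E := fun p ↦ ∫ s in (0 : ℝ)..p.2, Z (p.1, s) with hW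
  have hslice : ∀ {f : ℝ × ℝ → E}, Continuous f → ∀ u, Continuous fun s ↦ f (u, s) :=
    fun hf u ↦ hf.comp (Continuous.prodMk_right u)
  have hgc : Continuous g :=
    intervalIntegral.continuous_parametric_intervalIntegral_of_continuous
      (f := fun (p : ℝ × ℝ) s ↦ ξ (p.1, s)) (by fun_prop) continuous_snd
  have hWc : Continuous W :=
    intervalIntegral.continuous_parametric_intervalIntegral_of_continuous
      (f := fun (p : ℝ × ℝ) s ↦ Z (p.1, s)) (by fun_prop) continuous_snd
  have hgu : ∀ u t, HasDerivAt (fun u ↦ g (u, t)) (η (u, t) - W (u, t)) u := by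
    intro u t
    have h1 := hasDerivAt_intervalIntegral_param hξc hξu
      (fun u s ↦ hasDerivAt_mk_left (hξd (u, s))) 0 t u
    have h2 : ∫ s in (0 : ℝ)..t, fderiv ℝ ξ (u, s) (1, 0) = η (u, t) - W (u, t) := by
      simp only [hcurv]
      rw [intervalIntegral.integral_sub ((hslice hηt u).intervalIntegrable _ _)
        ((hslice hZ u).intervalIntegrable _ _),
        intervalIntegral.integral_eq_sub_of_hasDerivAt
          (fun s _ ↦ hasDerivAt_mk_right (hηd (u, s))) ((hslice hηt u).intervalIntegrable _ _),
        hη0, sub_zero]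
    rwa [h2] at h1
  have hgt : ∀ u t, HasDerivAt (fun t ↦ g (u, t)) (ξ (u, t)) t := fun u t ↦
    intervalIntegral.integral_hasDerivAt_right ((hslice hξc u).intervalIntegrable _ _)
      (hslice hξc u).aestronglyMeasurable.stronglyMeasurableAtFilter (hslice hξc u).continuousAt
  -- This is the integral of `∂ᵤ (B g ξ)`. At `u = 0` the factor `ξ` vanishes; at `u = 1` both `g`
  -- and `ξ` are multiples of `e`, and `B` is alternating.
  have hk : ∫ p in unitSquare, (B (η p - W p) (ξ p) + B (g p) (fderiv ℝ ξ p (1, 0))) = 0 := by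
    rw [setIntegral_unitSquare_deriv_fst (φ := fun p ↦ B (g p) (ξ p)) (by fun_prop)]
    · refine (intervalIntegral.integral_congr (g := fun _ ↦ (0 : ℝ)) fun t _ ↦ ?_).trans
        intervalIntegral.integral_zero
      have : g (1, t) = (∫ s in (0 : ℝ)..t, r s) • e := by
        simp only [hg, hξ1]
        exact intervalIntegral.integral_smul_const r e
      simp [hξ0, this, hξ1, hB]
    · intro u t
      have h := (B.hasFDerivAt.comp_hasDerivAt u (hgu u t)).clm_apply
        (hasDerivAt_mk_left (hξd (u, t)))
      exact h
  -- This is the integral of `∂ₜ (B g η)`; `η` vanishes at both ends.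
  have hm : ∫ p in unitSquare, (B (ξ p) (η p) + B (g p) (fderiv ℝ η p (0, 1))) = 0 := by
    rw [setIntegral_unitSquare_deriv_snd (φ := fun p ↦ B (g p) (η p)) (by fun_prop)]
    · refine (intervalIntegral.integral_congr (g := fun _ ↦ (0 : ℝ)) fun t _ ↦ ?_).trans
        intervalIntegral.integral_zero
      simp [hη0, hη1]
    · intro u t
      exact (B.hasFDerivAt.comp_hasDerivAt t (hgt u t)).clm_apply
        (hasDerivAt_mk_right (hηd (u, t)))
  have hint : ∀ {f : ℝ × ℝ → ℝ}, Continuous f → IntegrableOn f unitSquare := fun hf ↦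
    hf.continuousOn.integrableOn_compact isCompact_unitSquare
  have hinner : ∀ p : ℝ × ℝ, ∫ s in (0 : ℝ)..p.2, (B (Z (p.1, s)) (ξ p) - B (Z p) (ξ (p.1, s)))
      = B (W p) (ξ p) + B (g p) (Z p) := by
    intro p
    have c1 : Continuous fun s ↦ B (Z (p.1, s)) (ξ p) :=
      (B.continuous.comp (hslice hZ p.1)).clm_apply continuous_const
    have c2 : Continuous fun s ↦ B (Z p) (ξ (p.1, s)) := (B (Z p)).continuous.comp (hslice hξc p.1)
    rw [intervalIntegral.integral_sub (c1.intervalIntegrable _ _) (c2.intervalIntegrable _ _),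
      hswap (g p), sub_eq_add_neg]
    congr 1
    · exact (B.flip (ξ p)).intervalIntegral_comp_comm ((hslice hZ p.1).intervalIntegrable _ _)
    · congr 1
      exact (B (Z p)).intervalIntegral_comp_comm ((hslice hξc p.1).intervalIntegrable _ _)
  simp only [hinner]
  rw [← integral_const_mul, ← sub_eq_zero]
  -- In the difference the terms `B g (∂ₜη)` cancel, while `B η ξ` and `-B ξ η` add up to the factor
  -- `2`.
  have hsum : (∫ p in unitSquare, (B (η p - W p) (ξ p) + B (g p) (fderiv ℝ ξ p (1, 0))))
      - ∫ p in unitSquare, (B (ξ p) (η p) + B (g p) (fderiv ℝ η p (0, 1))) = 0 := by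
    rw [hk, hm, sub_zero]
  rw [← integral_sub (hint (by fun_prop)) (hint (by fun_prop))] at hsum ⊢
  rw [← hsum]
  congr 1
  funext p
  rw [hcurv, hswap (ξ p) (η p)]
  simp only [map_sub, sub_apply]
  ring

end Area

/-! ### Continuity and smoothness checked in charts. -/

section FromCharts

variable {n : ℕ} {X : Type*} [TopologicalSpace X]
  [ChartedSpace (EuclideanSpace ℝ (Fin (2 * n))) X]

theorem continuous_of_echart {P Y : Type*} [TopologicalSpace P] [TopologicalSpace Y]
    {f : P × X → Y}
    (hf : ∀ c : X, ContinuousOn (fun z : P × EuclideanSpace ℝ (Fin (2 * n)) ↦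
      f (z.1, (echart n c).symm z.2)) (univ ×ˢ (echart n c).target)) : Continuous f := by
  rw [continuous_iff_continuousAt]
  rintro ⟨p, x⟩
  have hx : x ∈ (echart n x).source := mem_extChartAt_source x
  have hT : IsOpen ((univ : Set P) ×ˢ (echart n x).target) :=
    isOpen_univ.prod (isOpen_echart_target x)
  have h1 : ContinuousAt (fun z : P × EuclideanSpace ℝ (Fin (2 * n)) ↦
      f (z.1, (echart n x).symm z.2)) (p, echart n x x) :=
    (hf x).continuousAt (hT.mem_nhds ⟨mem_univ _, (echart n x).map_source hx⟩)
  have h2 : ContinuousAt (fun z : P × X ↦ (z.1, echart n x z.2)) (p, x) :=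
    continuousAt_fst.prodMk
      ((continuousAt_extChartAt (I := 𝓡 (2 * n)) x).comp (x := (p, x)) continuousAt_snd)
  have h3 : ContinuousAt (fun z : P × X ↦ f (z.1, (echart n x).symm (echart n x z.2))) (p, x) :=
    ContinuousAt.comp (g := fun z : P × EuclideanSpace ℝ (Fin (2 * n)) ↦
      f (z.1, (echart n x).symm z.2)) (f := fun z : P × X ↦ (z.1, echart n x z.2)) h1 h2
  refine h3.congr ?_
  have h4 : ∀ᶠ z : P × X in 𝓝 (p, x), z.2 ∈ (echart n x).source :=
    continuousAt_snd.preimage_mem_nhds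
      ((isOpen_extChartAt_source (I := 𝓡 (2 * n)) x).mem_nhds hx)
  filter_upwards [h4] with z hz
  rw [(echart n x).left_inv hz]

variable [IsManifold (𝓡 (2 * n)) ∞ X]

theorem contMDiff_of_echart {f : X → ℝ}
    (hf : ∀ c : X, ContDiffOn ℝ ∞ (f ∘ (echart n c).symm) (echart n c).target) :
    ContMDiff (𝓡 (2 * n)) 𝓘(ℝ, ℝ) ∞ f := by
  intro x
  have hx : x ∈ (echart n x).source := mem_extChartAt_source x
  have h1 : ContDiffAt ℝ ∞ (f ∘ (echart n x).symm) (echart n x x) :=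
    (hf x).contDiffAt (echart_target_mem_nhds ((echart n x).map_source hx))
  refine (h1.contMDiffAt.comp x (contMDiffAt_echart hx)).congr_of_eventuallyEq ?_
  filter_upwards [(isOpen_extChartAt_source (I := 𝓡 (2 * n)) x).mem_nhds hx] with z hz
  simp only [Function.comp]
  rw [(echart n x).left_inv hz]

theorem fderiv_comp_echart_symm {f : X → ℝ} (hf : ContMDiff (𝓡 (2 * n)) 𝓘(ℝ, ℝ) ∞ f) {c : X}
    {y : EuclideanSpace ℝ (Fin (2 * n))} (hy : y ∈ (echart n c).target)
    (v : EuclideanSpace ℝ (Fin (2 * n))) :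
    fderiv ℝ (f ∘ (echart n c).symm) y v
      = mfderiv (𝓡 (2 * n)) 𝓘(ℝ, ℝ) f ((echart n c).symm y)
        (mfderiv 𝓘(ℝ, EuclideanSpace ℝ (Fin (2 * n))) (𝓡 (2 * n)) (echart n c).symm y v) := by
  have h := mfderiv_comp y (hf.mdifferentiableAt (by simp)) (mdifferentiableAt_echart_symm hy)
  rw [mfderiv_eq_fderiv] at h
  exact congrArg (fun A ↦ A v) h

end FromCharts

/-! ### Families of symplectic maps: velocities at the source and area density. -/

section Family

variable {n : ℕ} {X : Type*} [TopologicalSpace X]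
  [ChartedSpace (EuclideanSpace ℝ (Fin (2 * n))) X] [IsManifold (𝓡 (2 * n)) ∞ X]
  {Q : Type*} [NormedAddCommGroup Q] [NormedSpace ℝ Q] [FiniteDimensional ℝ Q]

namespace SymplecticForm

theorem ext_form (Ω : SymplecticForm n X) {x : X} {v v' : TangentSpace (𝓡 (2 * n)) x}
    (h : ∀ w, Ω.toFun x v w = Ω.toFun x v' w) : v = v' := by
  rw [← sub_eq_zero]
  refine Ω.nondegenerate' x _ fun w ↦ ?_
  rw [map_sub, sub_apply, h, sub_self]

/-- A smooth family of injective symplectic maps. -/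
structure IsSymplecticFamily (Ω : SymplecticForm n X) (G : Q → X → X) : Prop where
  contMDiff : ContMDiff (𝓘(ℝ, Q).prod (𝓡 (2 * n))) (𝓡 (2 * n)) ∞ (fun z : Q × X ↦ G z.1 z.2)
  isSymplecticMap : ∀ q, Ω.IsSymplecticMap (G q)
  injective : ∀ q, Function.Injective (G q)

variable {Ω : SymplecticForm n X} {G : Q → X → X}

variable (Ω G) in
/-- The vector `(dG_q)⁻¹ (∂ₐ G)` in the chart around `c`. -/
noncomputable def chartVelocity (c : X) (a : Q) (z : Q × EuclideanSpace ℝ (Fin (2 * n))) :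
    EuclideanSpace ℝ (Fin (2 * n)) :=
  (Ω.pullback (echart n c).symm z.2).inverse
    ((Ω.pullback (chartSlice G c) z (a, 0)).comp (ContinuousLinearMap.inr ℝ Q _))

namespace IsSymplecticFamily

variable (hG : Ω.IsSymplecticFamily G)

include hG

omit [FiniteDimensional ℝ Q] in
theorem contDiffOn_pullback_chartSlice (c : X) (v w : Q × EuclideanSpace ℝ (Fin (2 * n))) :
    ContDiffOn ℝ ∞ (fun z ↦ Ω.pullback (chartSlice G c) z v w) (univ ×ˢ (echart n c).target) :=
  Ω.contDiffOn_pullback_apply (isOpen_univ_prod_echart_target Q c)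
    (contMDiffOn_chartSlice hG.contMDiff c) v w

theorem contDiffOn_chartVelocity (c : X) (a : Q) :
    ContDiffOn ℝ ∞ (Ω.chartVelocity G c a) (univ ×ˢ (echart n c).target) := by
  intro z hz
  have h1 : ContDiffAt ℝ ∞ (fun z : Q × EuclideanSpace ℝ (Fin (2 * n)) ↦
      (Ω.pullback (echart n c).symm z.2).inverse) z :=
    (contDiffAt_pullback_inverse hz.2).comp z contDiffAt_snd
  have h2 : ContDiffAt ℝ ∞ (Ω.pullback (chartSlice G c)) z :=
    (Ω.contDiffOn_pullback (isOpen_univ_prod_echart_target Q c)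
      (contMDiffOn_chartSlice hG.contMDiff c)).contDiffAt
      ((isOpen_univ_prod_echart_target Q c).mem_nhds hz)
  exact (h1.clm_apply ((h2.clm_apply contDiffAt_const).clm_comp contDiffAt_const)).contDiffWithinAt

omit [FiniteDimensional ℝ Q] hG in
theorem pullback_chartVelocity {c : X} {q : Q} {y : EuclideanSpace ℝ (Fin (2 * n))}
    (hy : y ∈ (echart n c).target) (a : Q) (w : EuclideanSpace ℝ (Fin (2 * n))) :
    Ω.pullback (echart n c).symm y (Ω.chartVelocity G c a (q, y)) w
      = Ω.pullback (chartSlice G c) (q, y) (a, 0) (0, w) := by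
  have h := (Ω.isInvertible_pullback_echart_symm hy).inverse_apply_eq
    (y := (Ω.pullback (chartSlice G c) (q, y) (a, 0)).comp (ContinuousLinearMap.inr ℝ Q _))
    (x := Ω.chartVelocity G c a (q, y))
  exact (congrArg (fun A : EuclideanSpace ℝ (Fin (2 * n)) →L[ℝ] ℝ ↦ A w) (h.1 rfl)).symm

omit [FiniteDimensional ℝ Q] in
theorem pullback_chartSlice_inr {c : X} {q : Q} {y : EuclideanSpace ℝ (Fin (2 * n))}
    (hy : y ∈ (echart n c).target) (v w : EuclideanSpace ℝ (Fin (2 * n))) :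
    Ω.pullback (chartSlice G c) (q, y) (0, v) (0, w) = Ω.pullback (echart n c).symm y v w := by
  rw [pullback_apply, mfderiv_chartSlice_right hG.contMDiff hy,
    mfderiv_chartSlice_right hG.contMDiff hy]
  exact (hG.isSymplecticMap q).map_form _ _ _

omit [FiniteDimensional ℝ Q] in
-- As `dG_q` is onto, it suffices to pair both sides with vectors `dG_q v`. There symplecticity
-- reduces the claim to the equation that defines the chart velocity.
theorem mfderiv_chartSlice_chartVelocity {c : X} {q : Q} {y : EuclideanSpace ℝ (Fin (2 * n))}
    (hy : y ∈ (echart n c).target) (a : Q) :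
    mfderiv 𝓘(ℝ, Q × EuclideanSpace ℝ (Fin (2 * n))) (𝓡 (2 * n)) (chartSlice G c) (q, y)
      ((0, Ω.chartVelocity G c a (q, y)) : Q × EuclideanSpace ℝ (Fin (2 * n)))
      = mfderiv 𝓘(ℝ, Q × EuclideanSpace ℝ (Fin (2 * n))) (𝓡 (2 * n)) (chartSlice G c) (q, y)
      ((a, 0) : Q × EuclideanSpace ℝ (Fin (2 * n))) := by
  refine Ω.ext_form fun w ↦ ?_
  obtain ⟨v, rfl⟩ := (hG.isSymplecticMap q).mfderiv_surjective ((echart n c).symm y) w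
  obtain ⟨d, rfl⟩ := exists_mfderiv_echart_symm_eq hy v
  rw [← mfderiv_chartSlice_right hG.contMDiff hy]
  exact (hG.pullback_chartSlice_inr hy _ _).trans (pullback_chartVelocity hy a d)

omit [FiniteDimensional ℝ Q] in
-- Moves `Ω(∂ₐG, ∂_bG)` from the varying point `G q x` back to the fixed tangent space at the
-- source.
theorem pullback_chartSlice_inl {c : X} {q : Q} {y : EuclideanSpace ℝ (Fin (2 * n))}
    (hy : y ∈ (echart n c).target) (a b : Q) :
    Ω.pullback (chartSlice G c) (q, y) (a, 0) (b, 0)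
      = Ω.pullback (echart n c).symm y (Ω.chartVelocity G c a (q, y))
        (Ω.chartVelocity G c b (q, y)) := by
  rw [pullback_chartVelocity hy, pullback_apply, pullback_apply,
    hG.mfderiv_chartSlice_chartVelocity hy]

end IsSymplecticFamily

variable (Ω) in
/-- The density of the area of the square `p ↦ G p x`. -/
noncomputable def areaDensity (G : ℝ × ℝ → X → X) (p : ℝ × ℝ) (x : X) : ℝ :=
  Ω.pullback (fun q ↦ G q x) p (1, 0) (0, 1)

namespace IsSymplecticFamily

section Square

variable {G : ℝ × ℝ → X → X} (hG : Ω.IsSymplecticFamily G)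

/-- The vector `(dG_p)⁻¹ (∂ₜ G)`. -/
noncomputable def sourceVelocity (p : ℝ × ℝ) (x : X) : TangentSpace (𝓡 (2 * n)) x :=
  ((hG.isSymplecticMap p).mfderiv_surjective x
    (mfderiv 𝓘(ℝ, ℝ × ℝ) (𝓡 (2 * n)) (fun q ↦ G q x) p ((0, 1) : ℝ × ℝ))).choose

include hG

theorem areaDensity_echart_symm {c : X} {p : ℝ × ℝ} {y : EuclideanSpace ℝ (Fin (2 * n))}
    (hy : y ∈ (echart n c).target) :
    Ω.areaDensity G p ((echart n c).symm y)
      = Ω.pullback (chartSlice G c) (p, y) ((1, 0), 0) ((0, 1), 0) := by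
  rw [areaDensity, pullback_apply, pullback_apply, mfderiv_chartSlice_left hG.contMDiff hy,
    mfderiv_chartSlice_left hG.contMDiff hy]
  rfl

theorem contMDiff_areaDensity (p : ℝ × ℝ) :
    ContMDiff (𝓡 (2 * n)) 𝓘(ℝ, ℝ) ∞ (Ω.areaDensity G p) := by
  refine contMDiff_of_echart fun c ↦ ?_
  have h : ContDiffOn ℝ ∞ (fun y : EuclideanSpace ℝ (Fin (2 * n)) ↦
      Ω.pullback (chartSlice G c) (p, y) ((1, 0), 0) ((0, 1), 0)) (echart n c).target :=
    (hG.contDiffOn_pullback_chartSlice c ((1, 0), 0) ((0, 1), 0)).comp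
      (contDiff_prodMk_right p).contDiffOn fun y hy ↦ ⟨mem_univ _, hy⟩
  exact h.congr fun y hy ↦ hG.areaDensity_echart_symm hy

theorem fderiv_areaDensity_echart_symm {c : X} {p : ℝ × ℝ} {y : EuclideanSpace ℝ (Fin (2 * n))}
    (hy : y ∈ (echart n c).target) (v : EuclideanSpace ℝ (Fin (2 * n))) :
    fderiv ℝ (Ω.areaDensity G p ∘ (echart n c).symm) y v
      = fderiv ℝ (fun z ↦ Ω.pullback (chartSlice G c) z ((1, 0), 0) ((0, 1), 0)) (p, y) (0, v) := by
  have h1 : Ω.areaDensity G p ∘ (echart n c).symm =ᶠ[𝓝 y]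
      (fun z ↦ Ω.pullback (chartSlice G c) z ((1, 0), 0) ((0, 1), 0)) ∘ fun y ↦ (p, y) := by
    filter_upwards [echart_target_mem_nhds hy] with y' hy'
    exact hG.areaDensity_echart_symm hy'
  have h2 := ((hG.contDiffOn_pullback_chartSlice c ((1, 0), 0) ((0, 1), 0)).contDiffAt
    ((isOpen_univ_prod_echart_target (ℝ × ℝ) c).mem_nhds (x := (p, y)) ⟨mem_univ p, hy⟩)).differentiableAt
    (by simp)
  rw [h1.fderiv_eq, (h2.hasFDerivAt.comp y (hasFDerivAt_prodMk_right p y)).fderiv]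
  rfl

theorem mfderiv_sourceVelocity (p : ℝ × ℝ) (x : X) :
    mfderiv (𝓡 (2 * n)) (𝓡 (2 * n)) (G p) x (hG.sourceVelocity p x)
      = mfderiv 𝓘(ℝ, ℝ × ℝ) (𝓡 (2 * n)) (fun q ↦ G q x) p ((0, 1) : ℝ × ℝ) :=
  ((hG.isSymplecticMap p).mfderiv_surjective x
    (mfderiv 𝓘(ℝ, ℝ × ℝ) (𝓡 (2 * n)) (fun q ↦ G q x) p ((0, 1) : ℝ × ℝ))).choose_spec

/-- Injectivity of `dG_p` makes the chosen preimage unique, so it inherits the regularity of the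
chart velocity. -/
theorem sourceVelocity_echart_symm {c : X} {p : ℝ × ℝ} {y : EuclideanSpace ℝ (Fin (2 * n))}
    (hy : y ∈ (echart n c).target) :
    hG.sourceVelocity p ((echart n c).symm y)
      = mfderiv 𝓘(ℝ, EuclideanSpace ℝ (Fin (2 * n))) (𝓡 (2 * n)) (echart n c).symm y
        (Ω.chartVelocity G c (0, 1) (p, y)) := by
  rw [← sub_eq_zero]
  refine (hG.isSymplecticMap p).mfderiv_injective ?_
  rw [map_sub, sub_eq_zero, hG.mfderiv_sourceVelocity, ← mfderiv_chartSlice_right hG.contMDiff hy,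
    hG.mfderiv_chartSlice_chartVelocity hy, mfderiv_chartSlice_left hG.contMDiff hy]

/-- The derivative of the area density at `p'` in the direction of the source velocity at `p`. -/
noncomputable def crossDerivative (p' p : ℝ × ℝ) (x : X) : ℝ :=
  mfderiv (𝓡 (2 * n)) 𝓘(ℝ, ℝ) (Ω.areaDensity G p') x (hG.sourceVelocity p x)

theorem crossDerivative_echart_symm {c : X} {p' p : ℝ × ℝ} {y : EuclideanSpace ℝ (Fin (2 * n))}
    (hy : y ∈ (echart n c).target) :
    hG.crossDerivative p' p ((echart n c).symm y)
      = fderiv ℝ (fun z ↦ Ω.pullback (chartSlice G c) z ((1, 0), 0) ((0, 1), 0)) (p', y)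
        (0, Ω.chartVelocity G c (0, 1) (p, y)) := by
  rw [crossDerivative, hG.sourceVelocity_echart_symm hy, ← hG.fderiv_areaDensity_echart_symm hy,
    fderiv_comp_echart_symm (hG.contMDiff_areaDensity p') hy]

theorem continuous_crossDerivative :
    Continuous fun z : ((ℝ × ℝ) × (ℝ × ℝ)) × X ↦ hG.crossDerivative z.1.1 z.1.2 z.2 := by
  refine continuous_of_echart (n := n) fun c ↦ ?_
  have hS := isOpen_univ_prod_echart_target (ℝ × ℝ) c (n := n)
  have h1 := (hG.contDiffOn_pullback_chartSlice c ((1, 0), 0) ((0, 1), 0)).continuousOn_fderiv_of_isOpen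
    hS (by simp)
  have h2 := (hG.contDiffOn_chartVelocity c (0, 1)).continuousOn
  have h3 : ContinuousOn (fun z : ((ℝ × ℝ) × (ℝ × ℝ)) × EuclideanSpace ℝ (Fin (2 * n)) ↦
      fderiv ℝ (fun z ↦ Ω.pullback (chartSlice G c) z ((1, 0), 0) ((0, 1), 0)) (z.1.1, z.2)
        (0, Ω.chartVelocity G c (0, 1) (z.1.2, z.2))) (univ ×ˢ (echart n c).target) := by
    refine ContinuousOn.clm_apply ?_ (continuousOn_const.prodMk ?_)
    · exact h1.comp (f := fun z : ((ℝ × ℝ) × (ℝ × ℝ)) × EuclideanSpace ℝ (Fin (2 * n)) ↦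
        (z.1.1, z.2)) (by fun_prop) fun z hz ↦ ⟨mem_univ _, hz.2⟩
    · exact h2.comp (f := fun z : ((ℝ × ℝ) × (ℝ × ℝ)) × EuclideanSpace ℝ (Fin (2 * n)) ↦
        (z.1.2, z.2)) (by fun_prop) fun z hz ↦ ⟨mem_univ _, hz.2⟩
  exact h3.congr fun z hz ↦ hG.crossDerivative_echart_symm hz.2

end Square

end IsSymplecticFamily

end SymplecticForm

end Family

/-! ### The velocities are divergence free. -/

section DivergenceFree

variable {n : ℕ} {X : Type*} [TopologicalSpace X]
  [ChartedSpace (EuclideanSpace ℝ (Fin (2 * n))) X] [IsManifold (𝓡 (2 * n)) ∞ X]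

/-- Differentiation under the integral sign of a smooth family of functions on a compact
manifold. -/
theorem hasDerivAt_integral_contMDiff [T2Space X] [CompactSpace X] [MeasurableSpace X]
    [BorelSpace X] (μ : Measure X) [IsFiniteMeasure μ] {R : ℝ × X → ℝ}
    (hR : ContMDiff (𝓘(ℝ, ℝ).prod (𝓡 (2 * n))) 𝓘(ℝ, ℝ) ∞ R) (t : ℝ) :
    HasDerivAt (fun τ ↦ ∫ x, R (τ, x) ∂μ) (∫ x, deriv (fun τ ↦ R (τ, x)) t ∂μ) t := by
  have hder : ∀ τ x, DifferentiableAt ℝ (fun τ ↦ R (τ, x)) τ := fun τ x ↦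
    ((hR.comp (contMDiff_id.prodMk contMDiff_const)).contDiff.differentiable (by simp)) τ
  have hcont : Continuous fun z : ℝ × X ↦ deriv (fun τ ↦ R (τ, z.2)) z.1 := by
    refine continuous_of_echart (n := n) fun c ↦ ?_
    have hS := isOpen_univ_prod_echart_target ℝ c (n := n)
    have h1 : ContDiffOn ℝ ∞ (fun z : ℝ × EuclideanSpace ℝ (Fin (2 * n)) ↦
        R (z.1, (echart n c).symm z.2)) (univ ×ˢ (echart n c).target) :=
      (contMDiffOn_prod_echart_symm hR c).contDiffOn
    refine ((h1.continuousOn_fderiv_of_isOpen hS (by simp)).clm_apply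
      (continuousOn_const (c := ((1 : ℝ), (0 : EuclideanSpace ℝ (Fin (2 * n))))))).congr
        fun z hz ↦ ?_
    have h2 := ((h1.contDiffAt (hS.mem_nhds hz)).differentiableAt (by simp)).hasFDerivAt
    exact (h2.comp_hasDerivAt z.1 ((hasDerivAt_id z.1).prodMk (hasDerivAt_const z.1 z.2))).deriv
  have h := hasDerivAt_setIntegral_of_continuousOn μ isCompact_univ
    (J := fun τ x ↦ R (τ, x)) (J' := fun τ x ↦ deriv (fun τ ↦ R (τ, x)) τ) (r₀ := t) one_pos
    (fun r _ ↦ (hR.continuous.comp (Continuous.prodMk_right r)).continuousOn) hcont.continuousOn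
    fun r _ q _ ↦ (hder r q).hasDerivAt
  simpa only [Measure.restrict_univ] using h

namespace SymplecticForm.IsSymplecticFamily

variable {Ω : SymplecticForm n X} {G : ℝ × ℝ → X → X}

/-- Volume preservation makes the integral of `C ∘ G (u, τ)` independent of `τ` for every smooth
`C`. Differentiating at `τ = t` yields the claim for a suitable `C`. -/
theorem integral_crossDerivative [T2Space X] [CompactSpace X] [ConnectedSpace X]
    [MeasurableSpace X] [BorelSpace X] (hG : Ω.IsSymplecticFamily G) (p' p : ℝ × ℝ) :
    ∫ x, hG.crossDerivative p' p x ∂Ω.volumeMeasure = 0 := by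
  have := Ω.isFiniteMeasure_volumeMeasure
  obtain ⟨u, t⟩ := p
  obtain ⟨g, hg, hgG⟩ := (hG.isSymplecticMap (u, t)).exists_contMDiff_inverse (hG.injective (u, t))
  -- Chosen so that `C ∘ G (u, t)` is the area density at `p'`; then `dC(∂ₜG)` is its derivative
  -- along the source velocity.
  set C : X → ℝ := Ω.areaDensity G p' ∘ g with hCdef
  have hC : ContMDiff (𝓡 (2 * n)) 𝓘(ℝ, ℝ) ∞ C := (hG.contMDiff_areaDensity p').comp hg
  have hΓ : ContMDiff (𝓘(ℝ, ℝ).prod (𝓡 (2 * n))) (𝓡 (2 * n)) ∞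
      (fun z : ℝ × X ↦ G (u, z.1) z.2) :=
    hG.contMDiff.comp (((contDiff_prodMk_right u).contMDiff.comp contMDiff_fst).prodMk
      contMDiff_snd)
  have hR : ContMDiff (𝓘(ℝ, ℝ).prod (𝓡 (2 * n))) 𝓘(ℝ, ℝ) ∞
      (fun z : ℝ × X ↦ C (G (u, z.1) z.2)) := hC.comp hΓ
  have h1 := hasDerivAt_integral_contMDiff Ω.volumeMeasure hR t
  have hconst : ∀ τ, ∫ x, C (G (u, τ) x) ∂Ω.volumeMeasure = ∫ x, C x ∂Ω.volumeMeasure := by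
    intro τ
    have hmp := (hG.isSymplecticMap (u, τ)).measurePreserving (hG.injective (u, τ))
    exact hmp.integral_comp
      (((hG.isSymplecticMap (u, τ)).contMDiff.continuous.isClosedEmbedding
        (hG.injective (u, τ))).measurableEmbedding) C
  simp only [hconst] at h1
  have h2 := h1.unique (hasDerivAt_const t (∫ x, C x ∂Ω.volumeMeasure))
  rw [← h2]
  refine integral_congr_ae (Eventually.of_forall fun x ↦ ?_)
  have hCd : MDifferentiableAt (𝓡 (2 * n)) 𝓘(ℝ, ℝ) C (G (u, t) x) :=
    hC.mdifferentiableAt (by simp)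
  have e1 := mfderiv_comp (I := 𝓘(ℝ, ℝ)) t (f := fun τ ↦ G (u, τ) x) (g := C) hCd
    ((contMDiff_family_param hΓ x).mdifferentiableAt (by simp))
  have hq : HasFDerivAt (fun τ : ℝ ↦ (u, τ)) (ContinuousLinearMap.inr ℝ ℝ ℝ) t :=
    hasFDerivAt_prodMk_right u t
  have e2 := mfderiv_comp (I := 𝓘(ℝ, ℝ)) t (f := fun τ ↦ (u, τ)) (g := fun q ↦ G q x)
    ((contMDiff_family_param hG.contMDiff x).mdifferentiableAt (by simp))
    hq.differentiableAt.mdifferentiableAt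
  rw [mfderiv_eq_fderiv, hq.fderiv] at e2
  have e3 := mfderiv_comp (I := 𝓡 (2 * n)) x (f := G (u, t)) (g := C) hCd
    ((hG.isSymplecticMap (u, t)).contMDiff.mdifferentiableAt (by simp))
  have hCG : C ∘ G (u, t) = Ω.areaDensity G p' := by
    funext z
    simp only [hCdef, Function.comp, hgG]
  rw [hCG] at e3
  rw [mfderiv_eq_fderiv] at e1
  have f1 := congrArg (fun A : ℝ →L[ℝ] ℝ ↦ A 1) e1
  have f2 := congrArg (fun A : ℝ →L[ℝ] EuclideanSpace ℝ (Fin (2 * n)) ↦ A 1) e2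
  have f3 := congrArg (fun A : EuclideanSpace ℝ (Fin (2 * n)) →L[ℝ] ℝ ↦
    A (hG.sourceVelocity (u, t) x)) e3
  refine f3.trans ?_
  refine Eq.trans ?_ (f1.symm.trans (fderiv_apply_one_eq_deriv (f := C ∘ fun τ ↦ G (u, τ) x)))
  refine congrArg (mfderiv (𝓡 (2 * n)) 𝓘(ℝ, ℝ) C (G (u, t) x)) ?_
  exact (hG.mfderiv_sourceVelocity (u, t) x).trans f2.symm

end SymplecticForm.IsSymplecticFamily

end DivergenceFree

/-- Fubini, used once for the square and once for the inner variable. -/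
theorem integral_unitSquare_eq_zero {X : Type*} [TopologicalSpace X] [CompactSpace X] [T2Space X]
    [SecondCountableTopology X] [MeasurableSpace X] [BorelSpace X] (μ : Measure X)
    [IsFiniteMeasure μ] {D : ℝ × ℝ → ℝ × ℝ → X → ℝ}
    (hD : Continuous fun z : ((ℝ × ℝ) × (ℝ × ℝ)) × X ↦ D z.1.1 z.1.2 z.2)
    (h0 : ∀ p' p, ∫ x, D p' p x ∂μ = 0) :
    ∫ x, (∫ p in unitSquare, ∫ s in (0 : ℝ)..p.2, (D (p.1, s) p x - D p (p.1, s) x)) ∂μ = 0 := by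
  have hJ : Continuous fun z : (ℝ × ((ℝ × ℝ) × X)) ↦
      D (z.2.1.1, z.1) z.2.1 z.2.2 - D z.2.1 (z.2.1.1, z.1) z.2.2 :=
    (hD.comp (f := fun z : (ℝ × ((ℝ × ℝ) × X)) ↦ (((z.2.1.1, z.1), z.2.1), z.2.2))
      (by fun_prop)).sub
    (hD.comp (f := fun z : (ℝ × ((ℝ × ℝ) × X)) ↦ ((z.2.1, (z.2.1.1, z.1)), z.2.2))
      (by fun_prop))
  refine integral_setIntegral_eq_zero volume μ isCompact_unitSquare
    (Φ := fun p x ↦ ∫ s in (0 : ℝ)..p.2, (D (p.1, s) p x - D p (p.1, s) x)) ?_ fun p hp ↦ ?_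
  · exact intervalIntegral.continuous_parametric_intervalIntegral_of_continuous
      (f := fun (z : (ℝ × ℝ) × X) s ↦ D (z.1.1, s) z.1 z.2 - D z.1 (z.1.1, s) z.2)
      (hJ.comp continuous_swap) (continuous_snd.comp continuous_fst)
  · simp only [intervalIntegral.integral_of_le hp.2.1, ← integral_Icc_eq_integral_Ioc]
    refine integral_setIntegral_eq_zero volume μ isCompact_Icc
      (Φ := fun s x ↦ D (p.1, s) p x - D p (p.1, s) x)
      (hJ.comp (f := fun z : ℝ × X ↦ (z.1, (p, z.2))) (by fun_prop)) fun s _ ↦ ?_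
    have hc : ∀ p' p, Integrable (D p' p) μ := fun p' p ↦
      integrableOn_univ.1
        ((hD.comp (Continuous.prodMk_right (p', p))).continuousOn.integrableOn_compact
          isCompact_univ)
    rw [integral_sub (hc _ _) (hc _ _), h0, h0, sub_zero]

/-! ### The mean area of a Hamiltonian square is zero. -/

section Homotopy

variable {n : ℕ} {X : Type*} [TopologicalSpace X]
  [ChartedSpace (EuclideanSpace ℝ (Fin (2 * n))) X] [IsManifold (𝓡 (2 * n)) ∞ X]

/-- The differential of a function, with values in `ℝ`. -/
noncomputable def differential (F : X → ℝ) (x : X) (w : TangentSpace (𝓡 (2 * n)) x) : ℝ :=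
  mfderiv (𝓡 (2 * n)) 𝓘(ℝ, ℝ) F x w

namespace SymplecticForm

/-- A square of symplectic maps, equal to the identity on three sides, whose fourth side is
generated by the Hamiltonian `r t • F` composed with the inverse flow. -/
structure IsHamiltonianSquare (Ω : SymplecticForm n X) (F : X → ℝ) (r : ℝ → ℝ)
    (G : ℝ × ℝ → X → X) : Prop extends Ω.IsSymplecticFamily G where
  contMDiff_hamiltonian : ContMDiff (𝓡 (2 * n)) 𝓘(ℝ, ℝ) ∞ F
  continuous_speed : Continuous r
  left : ∀ t x, G (0, t) x = x
  bottom : ∀ u x, G (u, 0) x = x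
  top : ∀ u x, G (u, 1) x = x
  right : ∀ (t : ℝ) (x : X) (w : TangentSpace (𝓡 (2 * n)) x),
    Ω.toFun (G (1, t) x) (mfderiv 𝓘(ℝ, ℝ × ℝ) (𝓡 (2 * n)) (fun q ↦ G q x) (1, t)
        ((0, 1) : ℝ × ℝ)) (mfderiv (𝓡 (2 * n)) (𝓡 (2 * n)) (G (1, t)) x w)
      = -(r t * differential F x w)

omit [IsManifold (𝓡 (2 * n)) ∞ X] in
theorem mfderiv_apply_eq_zero_of_const {Q : Type*} [NormedAddCommGroup Q] [NormedSpace ℝ Q]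
    {g : Q → X} {p a : Q} (hg : MDifferentiableAt 𝓘(ℝ, Q) (𝓡 (2 * n)) g p)
    (h : ∀ τ : ℝ, g (p + τ • a) = g p) : mfderiv 𝓘(ℝ, Q) (𝓡 (2 * n)) g p a = 0 := by
  have h1 : HasFDerivAt (fun τ : ℝ ↦ p + τ • a)
      (ContinuousLinearMap.toSpanSingleton ℝ a) 0 := by
    have := ((ContinuousLinearMap.toSpanSingleton ℝ a).hasFDerivAt (x := (0 : ℝ))).const_add p
    simpa using this
  have hp : p + (0 : ℝ) • a = p := by simp
  have h2 := mfderiv_comp (I := 𝓘(ℝ, ℝ)) (0 : ℝ) (f := fun τ : ℝ ↦ p + τ • a) (g := g)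
    (by rw [hp]; exact hg) h1.differentiableAt.mdifferentiableAt
  have h3 : g ∘ (fun τ : ℝ ↦ p + τ • a) = fun _ ↦ g p := by
    funext τ
    exact h τ
  rw [h3, mfderiv_const, mfderiv_eq_fderiv, h1.fderiv] at h2
  have h4 := congrArg (fun A : ℝ →L[ℝ] EuclideanSpace ℝ (Fin (2 * n)) ↦ A 1) h2
  -- The chain rule gives the differential at `p + 0 • a`; this transports the result to `p`.
  have h5 : ∀ p' : Q, p' = p → ∀ A : Q →L[ℝ] EuclideanSpace ℝ (Fin (2 * n)),
      A = (by exact mfderiv 𝓘(ℝ, Q) (𝓡 (2 * n)) g p') →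
      A ((ContinuousLinearMap.toSpanSingleton ℝ a) 1) = 0 →
      mfderiv 𝓘(ℝ, Q) (𝓡 (2 * n)) g p a = 0 := by
    rintro _ rfl A rfl hA
    rw [ContinuousLinearMap.toSpanSingleton_apply, one_smul] at hA
    exact hA
  exact h5 _ hp _ rfl h4.symm

namespace IsHamiltonianSquare

variable {Ω : SymplecticForm n X} {F : X → ℝ} {r : ℝ → ℝ} {G : ℝ × ℝ → X → X}
  (hG : Ω.IsHamiltonianSquare F r G) {c : X} {y : EuclideanSpace ℝ (Fin (2 * n))}

include hG

theorem mfderiv_chartSlice_eq_zero (hy : y ∈ (echart n c).target) {p a : ℝ × ℝ}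
    (h : ∀ (τ : ℝ) x, G (p + τ • a) x = G p x) :
    mfderiv 𝓘(ℝ, (ℝ × ℝ) × EuclideanSpace ℝ (Fin (2 * n))) (𝓡 (2 * n)) (chartSlice G c) (p, y)
      ((a, 0) : (ℝ × ℝ) × EuclideanSpace ℝ (Fin (2 * n))) = 0 := by
  rw [mfderiv_chartSlice_left hG.contMDiff hy]
  exact mfderiv_apply_eq_zero_of_const
    ((contMDiff_family_param hG.contMDiff _).mdifferentiableAt (by simp)) fun τ ↦ h τ _

theorem pullback_left (hy : y ∈ (echart n c).target) (t : ℝ)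
    (w : (ℝ × ℝ) × EuclideanSpace ℝ (Fin (2 * n))) :
    Ω.pullback (chartSlice G c) ((0, t), y) ((0, 1), 0) w = 0 := by
  rw [pullback_apply, hG.mfderiv_chartSlice_eq_zero hy (fun τ x ↦ by simp [hG.left]), map_zero]
  rfl

theorem pullback_bottom (hy : y ∈ (echart n c).target) (u : ℝ)
    (w : (ℝ × ℝ) × EuclideanSpace ℝ (Fin (2 * n))) :
    Ω.pullback (chartSlice G c) ((u, 0), y) ((1, 0), 0) w = 0 := by
  rw [pullback_apply, hG.mfderiv_chartSlice_eq_zero hy (fun τ x ↦ by simp [hG.bottom]), map_zero]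
  rfl

theorem pullback_top (hy : y ∈ (echart n c).target) (u : ℝ)
    (w : (ℝ × ℝ) × EuclideanSpace ℝ (Fin (2 * n))) :
    Ω.pullback (chartSlice G c) ((u, 1), y) ((1, 0), 0) w = 0 := by
  rw [pullback_apply, hG.mfderiv_chartSlice_eq_zero hy (fun τ x ↦ by simp [hG.top]), map_zero]
  rfl

theorem pullback_right (hy : y ∈ (echart n c).target) (t : ℝ)
    (w : EuclideanSpace ℝ (Fin (2 * n))) :
    Ω.pullback (chartSlice G c) ((1, t), y) ((0, 1), 0) (0, w)
      = -(r t * fderiv ℝ (F ∘ (echart n c).symm) y w) := by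
  rw [pullback_apply, mfderiv_chartSlice_right hG.contMDiff hy,
    mfderiv_chartSlice_left hG.contMDiff hy, fderiv_comp_echart_symm hG.contMDiff_hamiltonian hy]
  exact hG.right t _ _

theorem hasFDerivAt_pullback_prodMk (hy : y ∈ (echart n c).target) (p : ℝ × ℝ)
    (v w : (ℝ × ℝ) × EuclideanSpace ℝ (Fin (2 * n))) :
    HasFDerivAt (fun q : ℝ × ℝ ↦ Ω.pullback (chartSlice G c) (q, y) v w)
      ((fderiv ℝ (fun z ↦ Ω.pullback (chartSlice G c) z v w) (p, y)).comp
        (ContinuousLinearMap.inl ℝ (ℝ × ℝ) _)) p := by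
  have h1 := ((hG.contDiffOn_pullback_chartSlice c v w).contDiffAt
    ((isOpen_univ_prod_echart_target (ℝ × ℝ) c).mem_nhds (x := (p, y))
      ⟨mem_univ _, hy⟩)).differentiableAt (by simp)
  exact HasFDerivAt.comp (g := fun z ↦ Ω.pullback (chartSlice G c) z v w)
    (f := fun q : ℝ × ℝ ↦ (q, y)) p h1.hasFDerivAt (hasFDerivAt_prodMk_left p y)

/-- The zero curvature equation `∂ᵤ(ι_ξ Ω) - ∂ₜ(ι_η Ω) + dσ = 0`, with velocities at the source. -/
theorem pullback_closed_square (hy : y ∈ (echart n c).target) (p : ℝ × ℝ)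
    (w : EuclideanSpace ℝ (Fin (2 * n))) :
    fderiv ℝ (fun z ↦ Ω.pullback (chartSlice G c) z ((0, 1), 0) (0, w)) (p, y) ((1, 0), 0)
      - fderiv ℝ (fun z ↦ Ω.pullback (chartSlice G c) z ((1, 0), 0) (0, w)) (p, y) ((0, 1), 0)
      + fderiv ℝ (fun z ↦ Ω.pullback (chartSlice G c) z ((1, 0), 0) ((0, 1), 0)) (p, y) (0, w)
      = 0 := by
  have h := Ω.pullback_closed (isOpen_univ_prod_echart_target (ℝ × ℝ) c)
    (contMDiffOn_chartSlice hG.contMDiff c) (p := (p, y)) ⟨mem_univ _, hy⟩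
    ((1, 0), 0) ((0, 1), 0) (0, w)
  have h2 : (fun z ↦ Ω.pullback (chartSlice G c) z (0, w) ((1, 0), 0))
      = fun z ↦ -Ω.pullback (chartSlice G c) z ((1, 0), 0) (0, w) := by
    funext z
    exact Ω.pullback_swap _ _ _ _
  rw [h2, fderiv_fun_neg, neg_apply, ← sub_eq_add_neg] at h
  exact h

/-- With `x` fixed, `ξ`, `η` and `Z` are curves of vectors in one space with one constant form `B`,
so the formula for `two_mul_setIntegral_unitSquare` applies. -/
theorem two_mul_area_eq (x : X) :
    2 * ∫ p in unitSquare, Ω.areaDensity G p x = ∫ p in unitSquare, ∫ s in (0 : ℝ)..p.2,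
      (hG.crossDerivative (p.1, s) p x - hG.crossDerivative p (p.1, s) x) := by
  have hx : x ∈ (echart n x).source := mem_extChartAt_source x
  have hy := (echart n x).map_source hx
  have hleft : (echart n x).symm (echart n x x) = x := (echart n x).left_inv hx
  set y := echart n x x
  set B := Ω.pullback (echart n x).symm y with hBdef
  have hBinv : B.IsInvertible := Ω.isInvertible_pullback_echart_symm hy
  have hBalt : ∀ v, B v v = 0 := fun v ↦ Ω.alternating' _ _
  have hvel : ∀ a, ContDiff ℝ ∞ fun p ↦ Ω.chartVelocity G x a (p, y) := fun a ↦
    contDiffOn_univ.1 ((hG.contDiffOn_chartVelocity x a).comp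
      (contDiff_prodMk_left y).contDiffOn fun p _ ↦ ⟨mem_univ _, hy⟩)
  set ξ : ℝ × ℝ → EuclideanSpace ℝ (Fin (2 * n)) := fun p ↦ Ω.chartVelocity G x (0, 1) (p, y)
  set η : ℝ × ℝ → EuclideanSpace ℝ (Fin (2 * n)) := fun p ↦ Ω.chartVelocity G x (1, 0) (p, y)
  have hBξ : ∀ p w, B (ξ p) w = Ω.pullback (chartSlice G x) (p, y) ((0, 1), 0) (0, w) :=
    fun p w ↦ IsSymplecticFamily.pullback_chartVelocity hy _ w
  have hBη : ∀ p w, B (η p) w = Ω.pullback (chartSlice G x) (p, y) ((1, 0), 0) (0, w) :=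
    fun p w ↦ IsSymplecticFamily.pullback_chartVelocity hy _ w
  have hinj : ∀ v v', (∀ w, B v w = B v' w) → v = v' := by
    intro v v' h
    exact hBinv.injective (ContinuousLinearMap.ext h)
  set σ : (ℝ × ℝ) × EuclideanSpace ℝ (Fin (2 * n)) → ℝ :=
    fun z ↦ Ω.pullback (chartSlice G x) z ((1, 0), 0) ((0, 1), 0)
  -- `Z` is the vector field dual to `dσ`, so that `B (Z p') (ξ p)` is the cross derivative.
  set Z : ℝ × ℝ → EuclideanSpace ℝ (Fin (2 * n)) := fun p ↦
    B.inverse ((fderiv ℝ σ (p, y)).comp (ContinuousLinearMap.inr ℝ (ℝ × ℝ) _))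
  have hBZ : ∀ p w, B (Z p) w = fderiv ℝ σ (p, y) (0, w) := by
    intro p w
    have h := (hBinv.inverse_apply_eq (x := Z p)
      (y := (fderiv ℝ σ (p, y)).comp (ContinuousLinearMap.inr ℝ (ℝ × ℝ) _))).1 rfl
    exact (congrArg (fun A : EuclideanSpace ℝ (Fin (2 * n)) →L[ℝ] ℝ ↦ A w) h).symm
  have hZ : Continuous Z := by
    have h1 := (hG.contDiffOn_pullback_chartSlice x ((1, 0), 0)
      ((0, 1), 0)).continuousOn_fderiv_of_isOpen (isOpen_univ_prod_echart_target (ℝ × ℝ) x) (by simp)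
    have h2 : Continuous fun p : ℝ × ℝ ↦ fderiv ℝ σ (p, y) :=
      continuousOn_univ.1 (h1.comp (Continuous.prodMk_left y).continuousOn
        fun p _ ↦ ⟨mem_univ _, hy⟩)
    exact B.inverse.continuous.comp (h2.clm_comp continuous_const)
  have hdB : ∀ {ζ : ℝ × ℝ → EuclideanSpace ℝ (Fin (2 * n))} (_ : ContDiff ℝ ∞ ζ) {a : ℝ × ℝ}
      (_ : ∀ p w, B (ζ p) w = Ω.pullback (chartSlice G x) (p, y) (a, 0) (0, w)) (p b : ℝ × ℝ)
      (w : EuclideanSpace ℝ (Fin (2 * n))), B (fderiv ℝ ζ p b) w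
        = fderiv ℝ (fun z ↦ Ω.pullback (chartSlice G x) z (a, 0) (0, w)) (p, y) (b, 0) := by
    intro ζ hζ a h p b w
    have h1 := ((B.flip w).hasFDerivAt.comp p
      ((hζ.differentiable (by simp)) p).hasFDerivAt)
    have h2 := hG.hasFDerivAt_pullback_prodMk hy p (a, 0) (0, w)
    have h3 : (B.flip w) ∘ ζ = fun q ↦ Ω.pullback (chartSlice G x) (q, y) (a, 0) (0, w) := by
      funext q
      exact h q w
    rw [h3] at h1
    exact congrArg (fun A : ℝ × ℝ →L[ℝ] ℝ ↦ A b) (h1.unique h2)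
  have hcurv : ∀ p, fderiv ℝ ξ p (1, 0) = fderiv ℝ η p (0, 1) - Z p := by
    intro p
    refine hinj _ _ fun w ↦ ?_
    rw [map_sub, sub_apply, hdB (hvel _) hBξ, hdB (hvel _) hBη, hBZ]
    linarith [hG.pullback_closed_square hy p w]
  have hmain := two_mul_setIntegral_unitSquare hBalt (hvel (0, 1)) (hvel (1, 0)) hZ hcurv
    (fun t ↦ hinj _ _ fun w ↦ by
      rw [map_zero]
      exact (hBξ (0, t) w).trans (hG.pullback_left hy t _))
    (fun u ↦ hinj _ _ fun w ↦ by
      rw [map_zero]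
      exact (hBη (u, 0) w).trans (hG.pullback_bottom hy u _))
    (fun u ↦ hinj _ _ fun w ↦ by
      rw [map_zero]
      exact (hBη (u, 1) w).trans (hG.pullback_top hy u _))
    -- On the fourth side `B (ξ (1, t)) = -r t • dF`, so `ξ (1, t)` is `r t` times a vector
    -- independent of `t`.
    (r := r) (e := B.inverse (-fderiv ℝ (F ∘ (echart n x).symm) y))
    (fun t ↦ hinj _ _ fun w ↦ by
      have h := (hBinv.inverse_apply_eq (x := B.inverse (-fderiv ℝ (F ∘ (echart n x).symm) y))
        (y := -fderiv ℝ (F ∘ (echart n x).symm) y)).1 rfl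
      rw [map_smul, ← h]
      refine (hBξ (1, t) w).trans ((hG.pullback_right hy t w).trans ?_)
      simp)
  have harea : ∀ p, Ω.areaDensity G p x = B (η p) (ξ p) := by
    intro p
    conv_lhs => rw [← hleft]
    exact (hG.areaDensity_echart_symm hy).trans (hG.pullback_chartSlice_inl hy _ _)
  have hcross : ∀ p' p, hG.crossDerivative p' p x = B (Z p') (ξ p) := by
    intro p' p
    conv_lhs => rw [← hleft]
    exact (hG.crossDerivative_echart_symm hy).trans (hBZ p' _).symm
  simp only [harea, hcross]
  exact hmain

theorem integral_area_eq_zero [T2Space X] [CompactSpace X] [ConnectedSpace X]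
    [MeasurableSpace X] [BorelSpace X] :
    ∫ x, (∫ p in unitSquare, Ω.areaDensity G p x) ∂Ω.volumeMeasure = 0 := by
  have := Ω.isFiniteMeasure_volumeMeasure
  have : SecondCountableTopology X :=
    ChartedSpace.secondCountable_of_sigmaCompact (EuclideanSpace ℝ (Fin (2 * n))) X
  have h2 : (2 : ℝ) * ∫ x, (∫ p in unitSquare, Ω.areaDensity G p x) ∂Ω.volumeMeasure = 0 := by
    rw [← integral_const_mul]
    simp only [hG.two_mul_area_eq]
    exact integral_unitSquare_eq_zero Ω.volumeMeasure hG.continuous_crossDerivative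
      hG.integral_crossDerivative
  simpa using h2

end IsHamiltonianSquare

end SymplecticForm

end Homotopy

/-! ### The area differs from the Hamiltonian by a constant. -/

section AreaHamiltonian

variable {n : ℕ} {X : Type*} [TopologicalSpace X]
  [ChartedSpace (EuclideanSpace ℝ (Fin (2 * n))) X] [IsManifold (𝓡 (2 * n)) ∞ X]

namespace SymplecticForm

namespace IsHamiltonianSquare

variable {Ω : SymplecticForm n X} {F : X → ℝ} {r : ℝ → ℝ} {G : ℝ × ℝ → X → X}
  (hG : Ω.IsHamiltonianSquare F r G) {c : X}

include hG

/-- Integrate the zero curvature equation over the square. The `∂ₜ` term vanishes since top and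
bottom are constant in `u`; the `∂ᵤ` term leaves only the value at `u = 1`. -/
theorem setIntegral_fderiv_areaDensity {y : EuclideanSpace ℝ (Fin (2 * n))}
    (hy : y ∈ (echart n c).target) (w : EuclideanSpace ℝ (Fin (2 * n))) :
    ∫ p in unitSquare, fderiv ℝ (fun z ↦ Ω.pullback (chartSlice G c) z ((1, 0), 0) ((0, 1), 0))
      (p, y) (0, w) = (∫ t in (0 : ℝ)..1, r t) * fderiv ℝ (F ∘ (echart n c).symm) y w := by
  have hc : ∀ (v v' a : (ℝ × ℝ) × EuclideanSpace ℝ (Fin (2 * n))), Continuous fun p : ℝ × ℝ ↦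
      fderiv ℝ (fun z ↦ Ω.pullback (chartSlice G c) z v v') (p, y) a := by
    intro v v' a
    have h1 := (hG.contDiffOn_pullback_chartSlice c v v').continuousOn_fderiv_of_isOpen
      (isOpen_univ_prod_echart_target (ℝ × ℝ) c) (by simp)
    have h2 : Continuous fun p : ℝ × ℝ ↦
        fderiv ℝ (fun z ↦ Ω.pullback (chartSlice G c) z v v') (p, y) :=
      continuousOn_univ.1 (h1.comp (Continuous.prodMk_left y).continuousOn
        fun p _ ↦ ⟨mem_univ _, hy⟩)
    exact h2.clm_apply continuous_const
  have ht := setIntegral_unitSquare_deriv_snd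
    (φ := fun p ↦ Ω.pullback (chartSlice G c) (p, y) ((1, 0), 0) (0, w))
    (hc ((1, 0), 0) (0, w) ((0, 1), 0)) fun u t ↦ by
      have h := hG.hasFDerivAt_pullback_prodMk hy (u, t) ((1, 0), 0) (0, w)
      have h2 := hasDerivAt_mk_right h.differentiableAt
      rw [h.fderiv] at h2
      exact h2
  have hu := setIntegral_unitSquare_deriv_fst
    (φ := fun p ↦ Ω.pullback (chartSlice G c) (p, y) ((0, 1), 0) (0, w))
    (hc ((0, 1), 0) (0, w) ((1, 0), 0)) fun u t ↦ by
      have h := hG.hasFDerivAt_pullback_prodMk hy (u, t) ((0, 1), 0) (0, w)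
      have h2 := hasDerivAt_mk_left h.differentiableAt
      rw [h.fderiv] at h2
      exact h2
  simp only [hG.pullback_top hy, hG.pullback_bottom hy, sub_zero,
    intervalIntegral.integral_zero] at ht
  simp only [hG.pullback_left hy, hG.pullback_right hy, sub_zero, intervalIntegral.integral_neg,
    intervalIntegral.integral_mul_const] at hu
  have hint : ∀ {f : ℝ × ℝ → ℝ}, Continuous f → IntegrableOn f unitSquare := fun hf ↦
    hf.continuousOn.integrableOn_compact isCompact_unitSquare
  have hsub := integral_sub (hint (hc ((1, 0), 0) (0, w) ((0, 1), 0)))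
    (hint (hc ((0, 1), 0) (0, w) ((1, 0), 0)))
  rw [ht, hu, zero_sub, neg_neg] at hsub
  rw [← hsub]
  congr 1
  funext p
  linarith [hG.pullback_closed_square hy p w]

theorem hasDerivAt_area_line {y v : EuclideanSpace ℝ (Fin (2 * n))} {τ₀ : ℝ}
    (hy : y + τ₀ • v ∈ (echart n c).target) :
    HasDerivAt (fun τ : ℝ ↦ (∫ p in unitSquare, Ω.areaDensity G p ((echart n c).symm (y + τ • v)))
      - (∫ t in (0 : ℝ)..1, r t) * F ((echart n c).symm (y + τ • v))) 0 τ₀ := by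
  have hline : Continuous fun τ : ℝ ↦ y + τ • v := by fun_prop
  have hlined : ∀ τ, HasDerivAt (fun τ : ℝ ↦ y + τ • v) v τ := by
    intro τ
    simpa using ((hasDerivAt_id τ).smul_const v).const_add y
  obtain ⟨ε, hε, hball⟩ := Metric.nhds_basis_closedBall.mem_iff.1
    (hline.continuousAt.preimage_mem_nhds (echart_target_mem_nhds hy))
  have hS := isOpen_univ_prod_echart_target (ℝ × ℝ) c (n := n)
  have hcd := hG.contDiffOn_pullback_chartSlice c ((1, 0), 0) ((0, 1), 0)
  have hder := hasDerivAt_setIntegral_of_continuousOn volume isCompact_unitSquare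
    (J := fun τ p ↦ Ω.pullback (chartSlice G c) (p, y + τ • v) ((1, 0), 0) ((0, 1), 0))
    (J' := fun τ p ↦ fderiv ℝ (fun z ↦ Ω.pullback (chartSlice G c) z ((1, 0), 0) ((0, 1), 0))
      (p, y + τ • v) (0, v)) (r₀ := τ₀) hε ?_ ?_ ?_
  · have hF : HasDerivAt (fun τ : ℝ ↦ F ((echart n c).symm (y + τ • v)))
        (fderiv ℝ (F ∘ (echart n c).symm) (y + τ₀ • v) v) τ₀ := by
      have h1 : ContDiffOn ℝ ∞ (F ∘ (echart n c).symm) (echart n c).target :=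
        (hG.contMDiff_hamiltonian.comp_contMDiffOn (contMDiffOn_echart_symm c)).contDiffOn
      exact ((h1.contDiffAt (echart_target_mem_nhds hy)).differentiableAt
        (by simp)).hasFDerivAt.comp_hasDerivAt τ₀ (hlined τ₀)
    rw [hG.setIntegral_fderiv_areaDensity hy] at hder
    have h3 := hder.sub (hF.const_mul (∫ t in (0 : ℝ)..1, r t))
    rw [sub_self] at h3
    refine h3.congr_of_eventuallyEq ?_
    filter_upwards [Metric.closedBall_mem_nhds τ₀ hε] with τ hτ
    simp only [hG.areaDensity_echart_symm (hball hτ)]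
    rfl
  · intro τ hτ
    exact hcd.continuousOn.comp (f := fun p : ℝ × ℝ ↦ (p, y + τ • v)) (by fun_prop)
      fun p _ ↦ ⟨mem_univ _, hball hτ⟩
  · refine ContinuousOn.clm_apply ?_ continuousOn_const
    exact (hcd.continuousOn_fderiv_of_isOpen hS (by simp)).comp
      (f := fun z : ℝ × (ℝ × ℝ) ↦ (z.2, y + z.1 • v)) (by fun_prop)
      fun z hz ↦ ⟨mem_univ _, hball hz.1⟩
  · intro τ hτ p _
    have h1 := ((hcd.contDiffAt (hS.mem_nhds (x := (p, y + τ • v))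
      ⟨mem_univ _, hball hτ⟩)).differentiableAt (by simp)).hasFDerivAt
    exact h1.comp_hasDerivAt τ ((hasDerivAt_const τ p).prodMk (hlined τ))

/-- The difference is constant along segments inside a ball in a chart, hence locally constant,
hence constant by connectedness. -/
theorem area_sub_eq [ConnectedSpace X] (x x' : X) :
    (∫ p in unitSquare, Ω.areaDensity G p x) - (∫ t in (0 : ℝ)..1, r t) * F x
      = (∫ p in unitSquare, Ω.areaDensity G p x') - (∫ t in (0 : ℝ)..1, r t) * F x' := by
  set φ : X → ℝ := fun x ↦
    (∫ p in unitSquare, Ω.areaDensity G p x) - (∫ t in (0 : ℝ)..1, r t) * F x with hφ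
  have hloc : IsLocallyConstant φ := by
    rw [IsLocallyConstant.iff_eventually_eq]
    intro x
    have hx : x ∈ (echart n x).source := mem_extChartAt_source x
    have hy := (echart n x).map_source hx
    obtain ⟨δ, hδ, hball⟩ := Metric.mem_nhds_iff.1 (echart_target_mem_nhds hy)
    have hev : ∀ᶠ z in 𝓝 x, z ∈ (echart n x).source ∧
        echart n x z ∈ Metric.ball (echart n x x) δ :=
      Filter.Eventually.and ((isOpen_extChartAt_source (I := 𝓡 (2 * n)) x).mem_nhds hx)
        ((continuousAt_extChartAt x).preimage_mem_nhds (Metric.ball_mem_nhds _ hδ))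
    filter_upwards [hev] with z hz
    set y := echart n x x with hydef
    set v := echart n x z - y with hv
    have hmem : ∀ τ ∈ Icc (0 : ℝ) 1, y + τ • v ∈ (echart n x).target := by
      intro τ hτ
      refine hball ?_
      have := (convex_ball y δ).add_smul_sub_mem (Metric.mem_ball_self hδ) hz.2 hτ
      exact this
    have hder : ∀ τ ∈ Icc (0 : ℝ) 1,
        HasDerivAt (fun τ : ℝ ↦ φ ((echart n x).symm (y + τ • v))) 0 τ := fun τ hτ ↦
      hG.hasDerivAt_area_line (hmem τ hτ)
    have hconst := constant_of_has_deriv_right_zero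
      (fun τ hτ ↦ (hder τ hτ).continuousAt.continuousWithinAt)
      (fun τ hτ ↦ (hder τ (Ico_subset_Icc_self hτ)).hasDerivWithinAt) 1
      (right_mem_Icc.2 zero_le_one)
    have e1 : (echart n x).symm (y + (1 : ℝ) • v) = z := by
      rw [one_smul, hv, add_sub_cancel]
      exact (echart n x).left_inv hz.1
    have e0 : (echart n x).symm (y + (0 : ℝ) • v) = x := by
      rw [zero_smul, add_zero]
      exact (echart n x).left_inv hx
    rw [e1, e0] at hconst
    exact hconst
  exact hloc.apply_eq_of_isPreconnected isPreconnected_univ (mem_univ x) (mem_univ x')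

theorem integral_hamiltonian_eq [T2Space X] [CompactSpace X] [ConnectedSpace X]
    [MeasurableSpace X] [BorelSpace X] (hr : ∫ t in (0 : ℝ)..1, r t = 1) {s : X}
    (hs : ∫ p in unitSquare, Ω.areaDensity G p s = 0) :
    ∫ x, F x ∂Ω.volumeMeasure = Ω.volumeMeasure.real univ * F s := by
  have := Ω.isFiniteMeasure_volumeMeasure
  have h0 := hG.integral_area_eq_zero
  have h1 : ∀ x, ∫ p in unitSquare, Ω.areaDensity G p x = F x - F s := by
    intro x
    have h := hG.area_sub_eq x s
    rw [hs, hr] at h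
    linarith
  simp only [h1] at h0
  have hF : Integrable F Ω.volumeMeasure := integrableOn_univ.1
    (hG.contMDiff_hamiltonian.continuous.continuousOn.integrableOn_compact isCompact_univ)
  rw [integral_sub hF (integrable_const _), integral_const, smul_eq_mul, sub_eq_zero] at h0
  exact h0

end IsHamiltonianSquare

end SymplecticForm

end AreaHamiltonian

/-! ### The contraction as a Hamiltonian square, and the conclusion. -/

section Main

variable {n : ℕ} {X : Type*} [TopologicalSpace X]
  [ChartedSpace (EuclideanSpace ℝ (Fin (2 * n))) X] [IsManifold (𝓡 (2 * n)) ∞ X]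

namespace SymplecticForm

variable {Ω : SymplecticForm n X} {F : X → ℝ} {f : ℝ → X → X}

/-- Conservation of energy: `dF(X_F) = -Ω(X_F, X_F) = 0`. -/
theorem IsHamiltonianCircleAction.hamiltonian_apply (hf : Ω.IsHamiltonianCircleAction F f)
    (t : ℝ) (x : X) : F (f t x) = F x := by
  have hflow := hf.isHamiltonianFlow
  have hF : ContMDiff (𝓡 (2 * n)) 𝓘(ℝ, ℝ) ∞ F :=
    hflow.contMDiff_hamiltonian.comp (contMDiff_const (c := (0 : ℝ)).prodMk contMDiff_id)
  have hx := contMDiff_family_param hflow.contMDiff_flow x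
  have hd : Differentiable ℝ (F ∘ fun τ ↦ f τ x) :=
    (hF.comp hx).contDiff.differentiable (by simp)
  have h0 : ∀ τ, deriv (F ∘ fun τ ↦ f τ x) τ = 0 := by
    intro τ
    have h1 := mfderiv_comp (I := 𝓘(ℝ, ℝ)) τ (f := fun τ ↦ f τ x) (g := F)
      (hF.mdifferentiableAt (by simp)) (hx.mdifferentiableAt (by simp))
    rw [mfderiv_eq_fderiv] at h1
    have h2 := congrArg (fun A : ℝ →L[ℝ] ℝ ↦ A 1) h1
    have h3 := hflow.hamilton τ x (mfderiv 𝓘(ℝ, ℝ) (𝓡 (2 * n)) (fun τ ↦ f τ x) τ (1 : ℝ))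
    rw [Ω.alternating'] at h3
    rw [← fderiv_apply_one_eq_deriv]
    exact h2.trans (neg_eq_zero.1 h3.symm)
  have h := is_const_of_deriv_eq_zero hd h0 t 0
  simpa only [Function.comp, hflow.zero] using h

/-- The square obtained from a contraction of the loop `f` by a reparametrisation that extends it
smoothly to the plane. -/
noncomputable def smoothedSquare (h : ℝ × ℝ → X → X) (p : ℝ × ℝ) : X → X :=
  h (Real.smoothTransition p.1, Real.smoothTransition p.2)

theorem smoothTransition_mem_Icc (t : ℝ) : Real.smoothTransition t ∈ Icc (0 : ℝ) 1 :=
  ⟨Real.smoothTransition.nonneg t, Real.smoothTransition.le_one t⟩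

/-- The fourth side becomes `f (ρ t)` with `ρ` the smooth transition, whence the speed `ρ'`. -/
theorem isHamiltonianSquare_smoothedSquare [T2Space X] (hf : Ω.IsHamiltonianCircleAction F f)
    {h : ℝ × ℝ → X → X}
    (hsmooth : ContMDiffOn (𝓘(ℝ, ℝ × ℝ).prod (𝓡 (2 * n))) (𝓡 (2 * n)) ∞
      (fun q : (ℝ × ℝ) × X ↦ h q.1 q.2) (unitSquare ×ˢ univ))
    (hham : ∀ p ∈ unitSquare, h p ∈ Ω.Ham)
    (hbd : ∀ a ∈ Icc (0 : ℝ) 1, h (0, a) = id ∧ h (1, a) = f a ∧ h (a, 0) = id ∧ h (a, 1) = id) :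
    Ω.IsHamiltonianSquare F (deriv Real.smoothTransition) (smoothedSquare h) := by
  have hflow := hf.isHamiltonianFlow
  have hρ : ContDiff ℝ ∞ Real.smoothTransition := Real.smoothTransition.contDiff
  have hmem : ∀ p : ℝ × ℝ, (Real.smoothTransition p.1, Real.smoothTransition p.2) ∈ unitSquare :=
    fun p ↦ ⟨smoothTransition_mem_Icc _, smoothTransition_mem_Icc _⟩
  have hF : ContMDiff (𝓡 (2 * n)) 𝓘(ℝ, ℝ) ∞ F :=
    hflow.contMDiff_hamiltonian.comp (contMDiff_const (c := (0 : ℝ)).prodMk contMDiff_id)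
  have hcont : ContMDiff (𝓘(ℝ, ℝ × ℝ).prod (𝓡 (2 * n))) (𝓡 (2 * n)) ∞
      (fun z : (ℝ × ℝ) × X ↦ smoothedSquare h z.1 z.2) := by
    have h1 : ContDiff ℝ ∞
        fun p : ℝ × ℝ ↦ (Real.smoothTransition p.1, Real.smoothTransition p.2) :=
      (hρ.comp contDiff_fst).prodMk (hρ.comp contDiff_snd)
    exact hsmooth.comp_contMDiff ((h1.contMDiff.comp contMDiff_fst).prodMk contMDiff_snd)
      fun z ↦ ⟨hmem z.1, mem_univ _⟩
  have hright : ∀ t, smoothedSquare h (1, t) = f (Real.smoothTransition t) := by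
    intro t
    simp only [smoothedSquare, Real.smoothTransition.one]
    exact (hbd _ (smoothTransition_mem_Icc t)).2.1
  refine { contMDiff := hcont, isSymplecticMap := fun p ↦ isSymplecticMap_of_mem_ham
            (hham _ (hmem p)), injective := fun p ↦ injective_of_mem_ham (hham _ (hmem p)),
           contMDiff_hamiltonian := hF, continuous_speed := hρ.continuous_deriv (by simp),
           left := fun t x ↦ ?_, bottom := fun u x ↦ ?_, top := fun u x ↦ ?_,
           right := fun t x w ↦ ?_ }
  · simp only [smoothedSquare, Real.smoothTransition.zero]
    rw [(hbd _ (smoothTransition_mem_Icc t)).1]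
    rfl
  · simp only [smoothedSquare, Real.smoothTransition.zero]
    rw [(hbd _ (smoothTransition_mem_Icc u)).2.2.1]
    rfl
  · simp only [smoothedSquare, Real.smoothTransition.one]
    rw [(hbd _ (smoothTransition_mem_Icc u)).2.2.2]
    rfl
  · have hq : HasFDerivAt (fun τ : ℝ ↦ ((1 : ℝ), τ)) (ContinuousLinearMap.inr ℝ ℝ ℝ) t :=
      hasFDerivAt_prodMk_right 1 t
    have e1 := mfderiv_comp (I := 𝓘(ℝ, ℝ)) t (f := fun τ ↦ ((1 : ℝ), τ))
      (g := fun q ↦ smoothedSquare h q x)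
      ((contMDiff_family_param hcont x).mdifferentiableAt (by simp))
      hq.differentiableAt.mdifferentiableAt
    rw [mfderiv_eq_fderiv, hq.fderiv] at e1
    have hρd := (hρ.differentiable (by simp)) t
    have e2 := mfderiv_comp (I := 𝓘(ℝ, ℝ)) t (f := Real.smoothTransition)
      (g := fun τ ↦ f τ x)
      ((contMDiff_family_param hflow.contMDiff_flow x).mdifferentiableAt (by simp))
      hρd.mdifferentiableAt
    rw [mfderiv_eq_fderiv] at e2
    have hcurve : (fun q ↦ smoothedSquare h q x) ∘ (fun τ : ℝ ↦ ((1 : ℝ), τ))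
        = (fun τ ↦ f τ x) ∘ Real.smoothTransition := by
      funext τ
      exact congrFun (hright τ) x
    rw [hcurve] at e1
    let M : ℝ →L[ℝ] EuclideanSpace ℝ (Fin (2 * n)) := by
      exact mfderiv 𝓘(ℝ, ℝ) (𝓡 (2 * n)) (fun τ ↦ f τ x) (Real.smoothTransition t)
    have e3 : mfderiv 𝓘(ℝ, ℝ × ℝ) (𝓡 (2 * n)) (fun q ↦ smoothedSquare h q x) (1, t)
        ((0, 1) : ℝ × ℝ) =
        (deriv Real.smoothTransition t • M 1 : EuclideanSpace ℝ (Fin (2 * n))) := by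
      have g1 := congrArg (fun A : ℝ →L[ℝ] EuclideanSpace ℝ (Fin (2 * n)) ↦ A 1) (e1.symm.trans e2)
      refine Eq.trans g1 ?_
      change M (fderiv ℝ Real.smoothTransition t 1) = deriv Real.smoothTransition t • M 1
      rw [fderiv_apply_one_eq_deriv, ← map_smul, smul_eq_mul, mul_one]
    have e4 := mfderiv_comp (I := 𝓡 (2 * n)) x (f := f (Real.smoothTransition t)) (g := F)
      (hF.mdifferentiableAt (by simp))
      ((contMDiff_family_apply hflow.contMDiff_flow _).mdifferentiableAt (by simp))
    -- Invariance of `F` replaces `d(F ∘ f_τ)` by `dF`, independently of the time.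
    have hFf : F ∘ f (Real.smoothTransition t) = F :=
      funext fun z ↦ hf.hamiltonian_apply _ z
    rw [hFf] at e4
    have e5 := congrArg (fun A : EuclideanSpace ℝ (Fin (2 * n)) →L[ℝ] ℝ ↦ A w) e4
    rw [e3]
    have hmain : Ω.toFun (f (Real.smoothTransition t) x)
        (deriv Real.smoothTransition t • M 1 : EuclideanSpace ℝ (Fin (2 * n)))
        (mfderiv (𝓡 (2 * n)) (𝓡 (2 * n)) (f (Real.smoothTransition t)) x w)
        = -(deriv Real.smoothTransition t * differential F x w) := by
      refine (congrArg (fun A : TangentSpace (𝓡 (2 * n)) (f (Real.smoothTransition t) x) →L[ℝ] ℝ ↦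
        A (mfderiv (𝓡 (2 * n)) (𝓡 (2 * n)) (f (Real.smoothTransition t)) x w))
        ((Ω.toFun (f (Real.smoothTransition t) x)).map_smul _ (M 1))).trans ?_
      refine (congrArg (fun a : ℝ ↦ deriv Real.smoothTransition t * a)
        (hflow.hamilton (Real.smoothTransition t) x _)).trans ?_
      have e6 : differential F x w = _ := e5
      rw [e6]
      exact mul_neg _ _
    -- Bundles the point and the differential as functions of the map, so that `hright t` can be
    -- applied to both at once.
    let T : (X → X) → EuclideanSpace ℝ (Fin (2 * n)) → ℝ := fun φ v ↦
      Ω.toFun (φ x) v (mfderiv (𝓡 (2 * n)) (𝓡 (2 * n)) φ x w)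
    exact (congrArg (fun φ ↦ T φ _) (hright t)).trans hmain

/-- A contraction of the loop sweeps out zero area over a Maslov-zero fixed point. -/
theorem setIntegral_areaDensity_fixedPoint (hmono : Ω.IsMonotone) {s : X}
    (hs : Ω.IsMaslovZeroFixedPoint f s) {r : ℝ → ℝ} {G : ℝ × ℝ → X → X}
    (hG : Ω.IsHamiltonianSquare F r G)
    (hright : ∀ t, G (1, t) = f (Real.smoothTransition t)) :
    ∫ p in unitSquare, Ω.areaDensity G p s = 0 := by
  obtain ⟨κ, -, hκ⟩ := hmono
  obtain ⟨hfix, b, U, P, θ, hb, hθ, hθ1, hUP⟩ := hs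
  have hv := contMDiff_family_param hG.contMDiff s
  have hsphere : IsSphere n (fun p ↦ G p s) s := by
    refine ⟨hv.contMDiffOn, fun a _ ↦ ⟨hG.left a s, ?_, hG.bottom a s, hG.top a s⟩⟩
    change G (1, a) s = s
    rw [hright, hfix]
  let M : (X → X) → EuclideanSpace ℝ (Fin (2 * n)) →L[ℝ] EuclideanSpace ℝ (Fin (2 * n)) :=
    fun φ ↦ by exact mfderiv (𝓡 (2 * n)) (𝓡 (2 * n)) φ s
  have hMid : ∀ φ : X → X, (∀ x, φ x = x) → ∀ w, M φ w = w := by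
    intro φ hφ w
    obtain rfl : φ = id := funext hφ
    have : M id = ContinuousLinearMap.id ℝ _ := mfderiv_id
    rw [this]
    rfl
  -- The trivialisation is `d_s G_p`. Its clutching loop is `d_s f` reparametrised by `ρ`, so the
  -- polar data and the angle of the given loop serve after composition with `ρ`, which fixes `0`
  -- and `1`.
  have hchern : Ω.HasChernNumber (fun p ↦ G p s) s 0 := by
    refine ⟨fun p ↦ mfderiv (𝓡 (2 * n)) (𝓡 (2 * n)) (G p) s, fun w ↦ ?_, fun p _ w w' ↦
      (hG.isSymplecticMap p).map_form s w w', fun a _ w ↦ ⟨?_, ?_, ?_⟩, b,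
      fun t ↦ U (Real.smoothTransition t), fun t ↦ P (Real.smoothTransition t),
      fun t ↦ θ (Real.smoothTransition t), hb, ?_, ?_, fun t _ ↦ ?_⟩
    · have hx : s ∈ (echart n s).source := mem_extChartAt_source s
      have hy := (echart n s).map_source hx
      have hleft : (echart n s).symm (echart n s s) = s := (echart n s).left_inv hx
      have key : ∀ w : TangentSpace (𝓡 (2 * n)) ((echart n s).symm (echart n s s)),
          ContinuousOn (fun p ↦ (⟨G p ((echart n s).symm (echart n s s)),
            mfderiv (𝓡 (2 * n)) (𝓡 (2 * n)) (G p) ((echart n s).symm (echart n s s)) w⟩ :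
              TangentBundle (𝓡 (2 * n)) X)) unitSquare := by
        intro w
        obtain ⟨d, rfl⟩ := exists_mfderiv_echart_symm_eq hy w
        have h1 := (contMDiffOn_mfderiv_apply (isOpen_univ_prod_echart_target (ℝ × ℝ) s)
          (contMDiffOn_chartSlice hG.contMDiff s) (0, d)).continuousOn
        have h2 := h1.comp (f := fun p : ℝ × ℝ ↦ (p, echart n s s)) (s := unitSquare)
          (by fun_prop) fun p _ ↦ ⟨mem_univ _, hy⟩
        refine h2.congr fun p _ ↦ ?_
        simp only [Function.comp]
        rw [mfderiv_chartSlice_right hG.contMDiff hy]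
        rfl
      rw [hleft] at key
      exact key w
    · exact hMid _ (hG.left a) w
    · exact hMid _ (hG.bottom a) w
    · exact hMid _ (hG.top a) w
    · exact hθ.comp Real.smoothTransition.continuous.continuousOn
        fun t _ ↦ smoothTransition_mem_Icc t
    · simpa [Real.smoothTransition.one, Real.smoothTransition.zero] using hθ1
    · obtain ⟨h1, h2, h3, h4⟩ := hUP _ (smoothTransition_mem_Icc t)
      refine ⟨h1, h2, ?_, h4⟩
      refine Eq.trans ?_ h3
      exact congrArg (fun φ ↦ LinearMap.toMatrix b b (M φ).toLinearMap) (hright t)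
  have harea := hκ _ s 0 hsphere hchern
  rw [Int.cast_zero, mul_zero] at harea
  rw [← harea, area]
  -- `area` uses derivatives within the square; they agree with the full derivatives since `G` is
  -- smooth on the plane.
  refine setIntegral_congr_fun isCompact_unitSquare.measurableSet fun p hp ↦ ?_
  have hu : UniqueMDiffWithinAt 𝓘(ℝ, ℝ × ℝ) unitSquare p :=
    (((uniqueDiffOn_Icc zero_lt_one).prod (uniqueDiffOn_Icc zero_lt_one)) p
      hp).uniqueMDiffWithinAt
  rw [mfderivWithin_eq_mfderiv hu (hv.mdifferentiableAt (by simp))]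
  rfl

end SymplecticForm

end Main

theorem mainTheorem2 (n : ℕ) {X : Type*} [TopologicalSpace X]
    [ChartedSpace (EuclideanSpace ℝ (Fin (2 * n))) X] [IsManifold (𝓡 (2 * n)) ∞ X]
    [T2Space X] [CompactSpace X] [ConnectedSpace X] [MeasurableSpace X] [BorelSpace X]
    (Ω : SymplecticForm n X) (hmono : Ω.IsMonotone)
    (F : X → ℝ) (f : ℝ → X → X) (hf : Ω.IsHamiltonianCircleAction F f)
    (s : X) (hs : Ω.IsMaslovZeroFixedPoint f s)
    (hF : ∫ x, F x ∂Ω.volumeMeasure ≠ Ω.volumeMeasure.real Set.univ * F s) :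
    ¬ Ω.IsContractibleInHam f := by
  rintro ⟨h, hsmooth, hham, hbd⟩
  have hG := SymplecticForm.isHamiltonianSquare_smoothedSquare hf hsmooth hham hbd
  refine hF (hG.integral_hamiltonian_eq ?_
    (SymplecticForm.setIntegral_areaDensity_fixedPoint hmono hs hG fun t ↦ ?_))
  -- The total speed is `ρ 1 - ρ 0 = 1`.
  · have hρ : ContDiff ℝ ∞ Real.smoothTransition := Real.smoothTransition.contDiff
    rw [intervalIntegral.integral_deriv_eq_sub (fun t _ ↦ (hρ.differentiable (by simp)) t)
      (hG.continuous_speed.intervalIntegrable _ _), Real.smoothTransition.one,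
      Real.smoothTransition.zero, sub_zero]
  · simp only [SymplecticForm.smoothedSquare, Real.smoothTransition.one]
    exact (hbd _ (SymplecticForm.smoothTransition_mem_Icc t)).2.1
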